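/- **Definitions.** For a compact Hausdorff space $X$ let $I(X)$ be the set of idempotent probability measures on $X$, i.e. of functionals $\mu\colon C(X)\to\mathbb R$ with $\mu(\lambda_X)=\lambda$, $\mu(\varphi+\lambda_X)=\mu(\varphi)+\lambda$ and $\mu(\max\{\varphi,\chi\})=\max\{\mu(\varphi),\mu(\chi)\}$ for all $\varphi,\chi\in C(X)$ and $\lambda\in\mathbb R$ ($\lambda_X$ is the constant function), with the topology of pointwise convergence; put $I(f)(\mu)(\varphi)=\mu(\varphi\circ f)$. Then $I$ is a functor from compact Hausdorff spaces to compact Hausdorff spaces. Let $\eta_X\colon X\to I(X)$, $\eta_X(x)=\delta_x$, $\delta_x(\varphi)=\varphi(x)$, and $\psi_X\colon I^2(X)\to I(X)$, $\psi_X(M)(\varphi)=M(\bar\varphi)$, where $\bar\varphi(\mu)=\mu(\varphi)$. Put $I^0(X)=X$, $I^{n+1}(X)=I(I^n(X))$, $\eta_{n,n+1}=\eta_{I^n(X)}$, $\eta_{0,n}=\eta_{n-1,n}\circ\dots\circ\eta_{0,1}$, $q_{1,n}=I(\eta_{0,n-1})\colon I(X)\to I^n(X)$. Let $I^+(X)$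 be the direct limit of $X\to I(X)\to I^2(X)\to\cdots$ along the maps $\eta_{n,n+1}$, with canonical maps $\eta_n\colon I^n(X)\to I^+(X)$, and let $I^+(f)(\eta_n(a))=\eta_n(I^n(f)(a))$. A *distance rule* assigns to every real function $d$ on $X\times X$ ($X$ compact Hausdorff) a real function $d_1$ on $I(X)\times I(X)$; iterating it gives functions $d_n$ on $I^n(X)$ (with $d_0=d$) and $d_+$ on $I^+(X)$, $d_+(\eta_n(a),\eta_n(b))=d_n(a,b)$. It is a *metrization* of $I$ if, whenever $d$ is a metric generating the topology of $X$, $d_1$ is a metric generating the topology of $I(X)$. Consider the following properties of a distance rule, for all metric compacta $(X,d)$, $(X_1,d^1)$, $(X_2,d^2)$: * P1: if $i\colon(X_1,d^1)\to(X_2,d^2)$ is an isometric embedding, then $I(i)$ is isometric from $d^1_1$ to $d^2_1$; * P2: $d_1(\eta_X(x),\eta_X(y))=d(x,y)$; * P3: $\operatorname{diam}(I(X),d_1)=\operatorname{diam}(X,d)$; * P4: for every continuous $f\colon X_1\to X_2$ the map $I^+(f)\colon(I^+(X_1),d^1_+)\to(I^+(X_2),d^2_+)$ is uniformly continuous; *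 P5: $d_1(\psi_X(M),\psi_X(N))\le d_2(M,N)$ for $M,N\in I^2(X)$; * P6: $d_1(\psi_X(N),\delta_x)=d_2(N,\delta_{\delta_x})$ for $N\in I^2(X)$, $x\in X$; * P7: if $\mu\in I(X)$ and $d_1(\mu,\delta_x)\ge\varepsilon$ for all $x\in X$, then $d_2(I(\eta_X)(\mu),\delta_\nu)\ge\varepsilon$ for all $\nu\in I(X)$, and $d_{i+1}(q_{1,i+1}(\mu),\eta_{i,i+1}(q_{1,i}(\mu)))\ge\varepsilon$ for all $i\ge1$. **Theorem.** The functor $I$ is perfect metrisable, that is: 1. $I$ is seminormal: it preserves the empty set and singletons, intersections of families of closed subsets, injective maps, and limits of inverse systems over nonempty directed sets; 2. $I$ is semimonadic: $\eta$ and $\psi$ are natural and $\psi_X\circ I(\eta_X)=\mathrm{id}_{I(X)}=\psi_X\circ\eta_{I(X)}$; 3. $I$ has a metrization with the properties P1–P6; moreover, it can be chosen to have P7 as well. In addition, the distance rule $\rho\mapsto\rho_1$, $$\rho_1(\mu,\nu)=\inf\bigl\{\sup\{\rho(x,y):(x,y)\in\operatorname{supp}\xi\}:\ \xi\in I(X\times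 X)\text{ with marginals }\mu,\nu\bigr\},$$ where $\operatorname{supp}\xi$ is the intersection of all closed sets $A$ with $\xi\in I(A)$, has the properties P1–P7. -/

import Mathlib

open CategoryTheory CategoryTheory.Limits

universe u

noncomputable section

/-! ### Idempotent probability measures -/

/-- Idempotent probability measures on `X`: functionals `C(X) → ℝ` that are normalised,
homogeneous for the max-plus multiplication, and preserve maxima. As a subtype of
`C(X, ℝ) → ℝ` it carries the topology of pointwise convergence. -/
abbrev IdempMeas (X : Type u) [TopologicalSpace X] : Type u :=
  {μ : C(X, ℝ) → ℝ //
    (∀ c : ℝ, μ (ContinuousMap.const X c) = c) ∧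
    (∀ (c : ℝ) (φ : C(X, ℝ)), μ (φ + ContinuousMap.const X c) = μ φ + c) ∧
    (∀ φ χ : C(X, ℝ), μ (φ ⊔ χ) = max (μ φ) (μ χ))}

namespace IdempMeas

variable {X Y : Type u} [TopologicalSpace X] [TopologicalSpace Y]

theorem mono (μ : IdempMeas X) {φ χ : C(X, ℝ)} (h : φ ≤ χ) : μ.1 φ ≤ μ.1 χ := by
  have h1 := μ.2.2.2 φ χ
  rw [sup_eq_right.2 h] at h1
  rw [h1]
  exact le_max_left _ _

theorem abs_apply_le [CompactSpace X] (μ : IdempMeas X) (φ : C(X, ℝ)) : |μ.1 φ| ≤ ‖φ‖ := by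
  rw [abs_le]
  constructor
  · have h : ContinuousMap.const X (-‖φ‖) ≤ φ := fun x =>
      (abs_le.1 (φ.norm_coe_le_norm x)).1
    simpa [μ.2.1] using μ.mono h
  · have h : φ ≤ ContinuousMap.const X ‖φ‖ := fun x =>
      (abs_le.1 (φ.norm_coe_le_norm x)).2
    simpa [μ.2.1] using μ.mono h

theorem isClosed_setOf : IsClosed {μ : C(X, ℝ) → ℝ |
    (∀ c : ℝ, μ (ContinuousMap.const X c) = c) ∧
    (∀ (c : ℝ) (φ : C(X, ℝ)), μ (φ + ContinuousMap.const X c) = μ φ + c) ∧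
    (∀ φ χ : C(X, ℝ), μ (φ ⊔ χ) = max (μ φ) (μ χ))} := by
  simp only [Set.ofPred_and, Set.ofPred_forall]
  refine IsClosed.inter ?_ (IsClosed.inter ?_ ?_)
  · exact isClosed_iInter fun c => isClosed_eq (continuous_apply _) continuous_const
  · exact isClosed_iInter fun c => isClosed_iInter fun φ =>
      isClosed_eq (continuous_apply _) ((continuous_apply _).add continuous_const)
  · exact isClosed_iInter fun φ => isClosed_iInter fun χ =>
      isClosed_eq (continuous_apply _) ((continuous_apply φ).max (continuous_apply χ))

instance compactSpace [CompactSpace X] : CompactSpace (IdempMeas X) := by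
  refine isCompact_iff_compactSpace.1 (IsCompact.of_isClosed_subset
    (isCompact_univ_pi fun φ : C(X, ℝ) => isCompact_Icc (a := -‖φ‖) (b := ‖φ‖))
    isClosed_setOf ?_)
  intro μ hμ φ _
  exact abs_le.1 (abs_apply_le ⟨μ, hμ⟩ φ)

/-- The push-forward `I(f)(μ)(φ) = μ(φ ∘ f)`. -/
def map (f : C(X, Y)) (μ : IdempMeas X) : IdempMeas Y :=
  ⟨fun φ => μ.1 (φ.comp f),
    fun c => μ.2.1 c,
    fun c φ => μ.2.2.1 c (φ.comp f),
    fun φ χ => μ.2.2.2 (φ.comp f) (χ.comp f)⟩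

theorem continuous_map (f : C(X, Y)) : Continuous (map f) :=
  Continuous.subtype_mk
    (continuous_pi fun φ => (continuous_apply (φ.comp f)).comp continuous_subtype_val) _

/-- The Dirac measure `δ_x(φ) = φ(x)`. -/
def dirac (x : X) : IdempMeas X :=
  ⟨fun φ => φ x, fun _ => rfl, fun _ _ => rfl, fun _ _ => rfl⟩

theorem continuous_dirac : Continuous (dirac : X → IdempMeas X) :=
  Continuous.subtype_mk (continuous_pi fun φ => φ.continuous) _

/-- The function `φ̄ : I(X) → ℝ`, `φ̄(μ) = μ(φ)`. -/
def eval (φ : C(X, ℝ)) : C(IdempMeas X, ℝ) :=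
  ⟨fun μ => μ.1 φ, (continuous_apply φ).comp continuous_subtype_val⟩

/-- The map `ψ_X : I(I(X)) → I(X)`, `ψ_X(M)(φ) = M(φ̄)`. -/
def join (M : IdempMeas (IdempMeas X)) : IdempMeas X :=
  ⟨fun φ => M.1 (eval φ),
    fun c => by
      have h : eval (ContinuousMap.const X c) = ContinuousMap.const (IdempMeas X) c := by
        ext μ; exact μ.2.1 c
      change M.1 (eval _) = c
      rw [h]; exact M.2.1 c,
    fun c φ => by
      have h : eval (φ + ContinuousMap.const X c)
          = eval φ + ContinuousMap.const (IdempMeas X) c := by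
        ext μ; exact μ.2.2.1 c φ
      change M.1 (eval _) = M.1 (eval φ) + c
      rw [h]; exact M.2.2.1 c _,
    fun φ χ => by
      have h : eval (φ ⊔ χ) = eval φ ⊔ eval χ := by
        ext μ; exact μ.2.2.2 φ χ
      change M.1 (eval _) = max (M.1 (eval φ)) (M.1 (eval χ))
      rw [h]; exact M.2.2.2 _ _⟩

theorem continuous_join : Continuous (join : IdempMeas (IdempMeas X) → IdempMeas X) :=
  Continuous.subtype_mk
    (continuous_pi fun φ => (eval (eval φ)).continuous) _

/-- The support of `μ`: the intersection of all closed `A ⊆ X` with `μ ∈ I(A)`, where `I(A)` is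
regarded as a subset of `I(X)` through the inclusion `A → X`. -/
def supp (μ : IdempMeas X) : Set X :=
  ⋂₀ {A : Set X | IsClosed A ∧
    ∃ ν : IdempMeas A, map ⟨Subtype.val, continuous_subtype_val⟩ ν = μ}

/-- The admissible measures `Λ(μ, ν)`: measures on `X × X` with marginals `μ` and `ν`. -/
def admissible (μ ν : IdempMeas X) : Set (IdempMeas (X × X)) :=
  {ξ | map ContinuousMap.fst ξ = μ ∧ map ContinuousMap.snd ξ = ν}

/-- `inf { sup { d(x, y) : (x, y) ∈ supp ξ } : ξ ∈ Λ(μ, ν) }`. -/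
def transportDist (d : X → X → ℝ) (μ ν : IdempMeas X) : ℝ :=
  sInf ((fun ξ : IdempMeas (X × X) => sSup ((fun p : X × X => d p.1 p.2) '' supp ξ)) ''
    admissible μ ν)

end IdempMeas

/-- The functor `I` of idempotent probability measures on compact Hausdorff spaces. -/
def idempFunctor : CompHaus.{u} ⥤ CompHaus.{u} where
  obj X := CompHaus.of (IdempMeas X)
  map {_ _} f := CompHausLike.ofHom _
    ⟨IdempMeas.map (ConcreteCategory.hom f), IdempMeas.continuous_map _⟩
  map_id _ := rfl
  map_comp _ _ := rfl

/-- The unit `η = δ : Id → I`. -/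
def idempUnit : 𝟭 CompHaus.{u} ⟶ idempFunctor.{u} where
  app X := CompHausLike.ofHom (fun _ => True) (X := X)
    ⟨IdempMeas.dirac, IdempMeas.continuous_dirac⟩
  naturality _ _ _ := rfl

/-- The multiplication `ψ : I² → I`. -/
def idempMult : idempFunctor.{u} ⋙ idempFunctor.{u} ⟶ idempFunctor.{u} where
  app X := CompHausLike.ofHom (fun _ => True) (X := IdempMeas (IdempMeas X)) (Y := IdempMeas X)
    ⟨IdempMeas.join, IdempMeas.continuous_join⟩
  naturality _ _ _ := rfl

/-! ### Seminormal and semimonadic functors -/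

/-- A closed subset of a compact Hausdorff space, as a compact Hausdorff space. -/
def closedSubspace (X : CompHaus.{u}) (A : TopologicalSpace.Closeds X) : CompHaus.{u} :=
  haveI : CompactSpace (A : Set X) := isCompact_iff_compactSpace.1 A.isClosed.isCompact
  CompHaus.of (A : Set X)

/-- The inclusion of a closed subset. -/
def closedIncl (X : CompHaus.{u}) (A : TopologicalSpace.Closeds X) : closedSubspace X A ⟶ X :=
  haveI : CompactSpace (A : Set X) := isCompact_iff_compactSpace.1 A.isClosed.isCompact
  CompHausLike.ofHom (fun _ => True) (X := (A : Set X)) (Y := X)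
    ⟨Subtype.val, continuous_subtype_val⟩

/-- Seminormal functors. An injective continuous map of compact Hausdorff spaces is the same as an
embedding; in `intersections`, `F(A)` is the image of `F(A) → F(X)`. -/
structure IsSeminormal (F : CompHaus.{u} ⥤ CompHaus.{u}) : Prop where
  empty : ∀ X : CompHaus.{u}, IsEmpty X → IsEmpty (F.obj X)
  singleton : ∀ X : CompHaus.{u}, Nonempty (Unique X) → Nonempty (Unique (F.obj X))
  intersections : ∀ (X : CompHaus.{u}) (B : Set (TopologicalSpace.Closeds X)),
    Set.range (F.map (closedIncl X (sInf B))) = ⋂ A ∈ B, Set.range (F.map (closedIncl X A))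
  monomorphic : ∀ (X Y : CompHaus.{u}) (f : X ⟶ Y), Function.Injective f →
    Function.Injective (F.map f)
  continuous : ∀ (A : Type u) [PartialOrder A] [IsDirectedOrder A] [Nonempty A],
    PreservesLimitsOfShape Aᵒᵖ F

/-- Semimonadic: both unit laws hold (naturality is part of the types of `η` and `ψ`). -/
structure IsSemimonadic (F : CompHaus.{u} ⥤ CompHaus.{u}) (η : 𝟭 CompHaus.{u} ⟶ F)
    (ψ : F ⋙ F ⟶ F) : Prop where
  map_unit : ∀ (X : CompHaus.{u}) (a : F.obj X), ψ.app X (F.map (η.app X) a) = a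
  unit_map : ∀ (X : CompHaus.{u}) (a : F.obj X), ψ.app X (η.app (F.obj X) a) = a

/-! ### Iterates of a functor and metrizations -/

/-- `d` is a metric on `X` that generates the topology of `X`. -/
structure IsCompatibleMetric (X : CompHaus.{u}) (d : X → X → ℝ) : Prop where
  eq_zero_iff : ∀ x y, d x y = 0 ↔ x = y
  symm : ∀ x y, d x y = d y x
  triangle : ∀ x y z, d x z ≤ d x y + d y z
  isOpen_iff : ∀ U : Set X, IsOpen U ↔ ∀ x ∈ U, ∃ ε > 0, ∀ y, d x y < ε → y ∈ U

/-- The diameter of `X` for the distance function `d`. -/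
def diameter (X : Type u) (d : X → X → ℝ) : ℝ :=
  sSup (Set.range fun p : X × X => d p.1 p.2)

/-- The iterates `F⁰ = Id`, `Fⁿ⁺¹ = F ∘ Fⁿ`. -/
def iter (F : CompHaus.{u} ⥤ CompHaus.{u}) : ℕ → (CompHaus.{u} ⥤ CompHaus.{u})
  | 0 => 𝟭 _
  | n + 1 => iter F n ⋙ F

/-- A rule that assigns to a distance function on `X` a distance function on `F(X)`. -/
def DistRule (F : CompHaus.{u} ⥤ CompHaus.{u}) : Type (u + 1) :=
  ∀ X : CompHaus.{u}, (X → X → ℝ) → (F.obj X → F.obj X → ℝ)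

section Iterates

variable {F : CompHaus.{u} ⥤ CompHaus.{u}}

/-- The distance `d_n` on `Fⁿ(X)`: `d_0 = d`, and `d_{n+1}` is obtained from `d_n` by the rule. -/
def iterDist (D : DistRule F) (X : CompHaus.{u}) (d : X → X → ℝ) :
    ∀ n : ℕ, (iter F n).obj X → (iter F n).obj X → ℝ
  | 0 => d
  | n + 1 => D ((iter F n).obj X) (iterDist D X d n)

/-- `η_{n,n+1} : Fⁿ(X) → Fⁿ⁺¹(X)`. -/
def unitStep (η : 𝟭 CompHaus.{u} ⟶ F) (X : CompHaus.{u}) (n : ℕ) :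
    (iter F n).obj X ⟶ (iter F (n + 1)).obj X :=
  η.app ((iter F n).obj X)

/-- `η_{0,n} : X → Fⁿ(X)`. -/
def unitIter (η : 𝟭 CompHaus.{u} ⟶ F) (X : CompHaus.{u}) :
    ∀ n : ℕ, X ⟶ (iter F n).obj X
  | 0 => 𝟙 X
  | n + 1 => unitIter η X n ≫ unitStep η X n

/-- `q_{1,n+1} = F(η_{0,n}) : F(X) → Fⁿ⁺¹(X)`. -/
def qMap (η : 𝟭 CompHaus.{u} ⟶ F) (X : CompHaus.{u}) (n : ℕ) :
    F.obj X ⟶ (iter F (n + 1)).obj X :=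
  F.map (unitIter η X n)

/-- The identifications `a ∼ η_{n,n+1}(a)` that define the direct limit. -/
inductive PlusRel (η : 𝟭 CompHaus.{u} ⟶ F) (X : CompHaus.{u}) :
    (Σ n : ℕ, (iter F n).obj X) → (Σ n : ℕ, (iter F n).obj X) → Prop
  | step (n : ℕ) (a : (iter F n).obj X) : PlusRel η X ⟨n, a⟩ ⟨n + 1, unitStep η X n a⟩

/-- `F⁺(X)`, the direct limit of `X → F(X) → F²(X) → ⋯` along the maps `η_{n,n+1}`. -/
def Plus (η : 𝟭 CompHaus.{u} ⟶ F) (X : CompHaus.{u}) : Type u :=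
  Quot (PlusRel η X)

/-- The canonical map `η_n : Fⁿ(X) → F⁺(X)`. -/
def toPlus (η : 𝟭 CompHaus.{u} ⟶ F) (X : CompHaus.{u}) (n : ℕ) (a : (iter F n).obj X) :
    Plus η X :=
  Quot.mk _ ⟨n, a⟩

/-- The map `F⁺(f)`, `η_n(a) ↦ η_n(Fⁿ(f)(a))`. -/
def plusMap (η : 𝟭 CompHaus.{u} ⟶ F) {X Y : CompHaus.{u}} (f : X ⟶ Y) : Plus η X → Plus η Y :=
  Quot.map (fun p => ⟨p.1, (iter F p.1).map f p.2⟩) (by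
    rintro _ _ ⟨n, a⟩
    have h : (iter F (n + 1)).map f (unitStep η X n a)
        = unitStep η Y n ((iter F n).map f a) :=
      (CategoryTheory.congr_fun (η.naturality ((iter F n).map f)) a).symm
    change PlusRel η Y _ ⟨n + 1, (iter F (n + 1)).map f (unitStep η X n a)⟩
    rw [h]
    exact PlusRel.step n _)

/-- The distance `d₊` on `F⁺(X)`: `d₊(η_n(a), η_n(b)) = d_n(a, b)`. When all maps `η_{n,n+1}` are
isometric, the set below has exactly one element. -/
def plusDist (η : 𝟭 CompHaus.{u} ⟶ F) (D : DistRule F) (X : CompHaus.{u}) (d : X → X → ℝ)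
    (p q : Plus η X) : ℝ :=
  sInf {r : ℝ | ∃ (n : ℕ) (a b : (iter F n).obj X),
    toPlus η X n a = p ∧ toPlus η X n b = q ∧ iterDist D X d n a b = r}

/-- The rule sends metrics generating the topology of a compactum `X` to metrics generating the
topology of `F(X)`. -/
def IsMetrization (D : DistRule F) : Prop :=
  ∀ (X : CompHaus.{u}) (d : X → X → ℝ), IsCompatibleMetric X d →
    IsCompatibleMetric (F.obj X) (D X d)

/-- The properties P1–P6. -/
structure PerfectProperties (η : 𝟭 CompHaus.{u} ⟶ F) (ψ : F ⋙ F ⟶ F) (D : DistRule F) :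
    Prop where
  /-- `F` preserves isometric embeddings. -/
  P1 : ∀ (X₁ X₂ : CompHaus.{u}) (d₁ : X₁ → X₁ → ℝ) (d₂ : X₂ → X₂ → ℝ),
    IsCompatibleMetric X₁ d₁ → IsCompatibleMetric X₂ d₂ →
    ∀ i : X₁ ⟶ X₂, (∀ x y, d₂ (i x) (i y) = d₁ x y) →
      ∀ a b : F.obj X₁, D X₂ d₂ (F.map i a) (F.map i b) = D X₁ d₁ a b
  /-- The unit is isometric. -/
  P2 : ∀ (X : CompHaus.{u}) (d : X → X → ℝ), IsCompatibleMetric X d →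
    ∀ x y : X, D X d (η.app X x) (η.app X y) = d x y
  /-- Diameters are preserved. -/
  P3 : ∀ (X : CompHaus.{u}) (d : X → X → ℝ), IsCompatibleMetric X d →
    diameter (F.obj X) (D X d) = diameter X d
  /-- `F⁺(f)` is uniformly continuous for every continuous `f`. -/
  P4 : ∀ (X₁ X₂ : CompHaus.{u}) (d₁ : X₁ → X₁ → ℝ) (d₂ : X₂ → X₂ → ℝ),
    IsCompatibleMetric X₁ d₁ → IsCompatibleMetric X₂ d₂ →
    ∀ f : X₁ ⟶ X₂, ∀ ε > 0, ∃ δ > 0, ∀ p q : Plus η X₁,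
      plusDist η D X₁ d₁ p q < δ → plusDist η D X₂ d₂ (plusMap η f p) (plusMap η f q) < ε
  /-- `ψ_X : (F²(X), d₂) → (F(X), d₁)` is non-expanding. -/
  P5 : ∀ (X : CompHaus.{u}) (d : X → X → ℝ), IsCompatibleMetric X d →
    ∀ a b : F.obj (F.obj X), D X d (ψ.app X a) (ψ.app X b) ≤ D (F.obj X) (D X d) a b
  /-- `d₁(ψ_X(a), η_{0,1}(x)) = d₂(a, η_{0,2}(x))`. -/
  P6 : ∀ (X : CompHaus.{u}) (d : X → X → ℝ), IsCompatibleMetric X d →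
    ∀ (a : F.obj (F.obj X)) (x : X),
      D X d (ψ.app X a) (η.app X x) = D (F.obj X) (D X d) a (η.app (F.obj X) (η.app X x))

/-- The property P7: if `a ∈ F(X)` has distance at least `ε` from `η(X)`, then `F(η)(a)` has
distance at least `ε` from `η(F(X))`, and also
`d_{i+1}(q_{1,i+1}(a), η_{i,i+1}(q_{1,i}(a))) ≥ ε` for every `i = n + 1 ≥ 1`. -/
structure PropertyP7 (η : 𝟭 CompHaus.{u} ⟶ F) (D : DistRule F) : Prop where
  far_from_unit : ∀ (X : CompHaus.{u}) (d : X → X → ℝ), IsCompatibleMetric X d →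
    ∀ (ε : ℝ) (a : F.obj X), (∀ x : X, ε ≤ D X d a (η.app X x)) →
      ∀ b : F.obj X, ε ≤ D (F.obj X) (D X d) (F.map (η.app X) a) (η.app (F.obj X) b)
  iterated : ∀ (X : CompHaus.{u}) (d : X → X → ℝ), IsCompatibleMetric X d →
    ∀ (ε : ℝ) (a : F.obj X), (∀ x : X, ε ≤ D X d a (η.app X x)) →
      ∀ n : ℕ, ε ≤ iterDist D X d (n + 2) (qMap η X (n + 1) a)
        (unitStep η X (n + 1) (qMap η X n a))

end Iterates

/-- The rule `ρ ↦ ρ_I` given by the transport formula. -/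
def transportRule : DistRule idempFunctor.{u} :=
  fun _ d => IdempMeas.transportDist d

end

/-! An idempotent measure μ is encoded by its density `dens μ`, an upper semicontinuous function X →
[0,1] with maximum 1. Compactness gives the max formula exp μ(φ) = max over x of dens μ x · exp φ(x)
(`exists_dens_mul_exp_eq`), so μ is determined by its density. In these terms δ_y is the indicator
of y, push-forward takes maxima over fibres, ψ takes max over μ of dens M μ · dens μ x, and supp is
the closure of the set where the density is positive. All suprema are attained
(`exists_dens_eq_mul`). Conversely `mix` builds measures from weights. Seminormality follows: the
image of I(f) consists of the measures whose density is positive only on the range of f, and the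
density of a limit measure is the infimum of the densities along a thread.

The transport rule sees only supports. It satisfies P1–P7 but is no metrization: on two points,
densities (1, t) with t → 0 converge to a Dirac measure while the distance to it stays constant. The
metrization is therefore `densDist`: each x with density p must have a partner y with density q such
that p·e^d ≤ q·e^r and p·(e^d − 1) ≤ q·(e^r − 1), where d = d(x, y). Both inequalities are needed.
The second alone always holds with y = x; the first alone ignores small mass far away.

The pair composes (`cost_trans`), which gives the triangle inequality. Against a Dirac measure only
the second inequality remains, and it is compatible with the max-product formula for ψ; this gives
P6 and P7. Partners can be followed through ψ, which gives P5. For P4, a modulus of the form e^{d'}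
≤ a(1 + K(e^d − 1)) is built from nonnegative combinations of the two inequalities, so it passes
from f to all Iⁿ(f) with the same constants (`Dominates.map`). Compatibility with the topology is
tested on the cone functions −L·d(x, ·). -/

noncomputable section

set_option linter.unusedSectionVars false

namespace IdempMeas

/-! ### Densities and the max formula. -/

section Density

variable {X : Type u} [TopologicalSpace X]

/-- The max-times density of an idempotent measure. -/
def dens (μ : IdempMeas X) (x : X) : ℝ :=
  ⨅ φ : C(X, ℝ), Real.exp (μ.1 φ - φ x)

theorem dens_bddBelow (μ : IdempMeas X) (x : X) :
    BddBelow (Set.range fun φ : C(X, ℝ) => Real.exp (μ.1 φ - φ x)) :=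
  ⟨0, by rintro _ ⟨φ, rfl⟩; exact (Real.exp_pos _).le⟩

theorem dens_nonneg (μ : IdempMeas X) (x : X) : 0 ≤ dens μ x :=
  Real.iInf_nonneg fun _ => (Real.exp_pos _).le

theorem dens_le (μ : IdempMeas X) (x : X) (φ : C(X, ℝ)) :
    dens μ x ≤ Real.exp (μ.1 φ - φ x) :=
  ciInf_le (dens_bddBelow μ x) φ

theorem apply_zero (μ : IdempMeas X) : μ.1 0 = 0 := μ.2.1 0

theorem dens_le_one (μ : IdempMeas X) (x : X) : dens μ x ≤ 1 := by
  simpa [apply_zero] using dens_le μ x 0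

theorem dens_mul_exp_le (μ : IdempMeas X) (φ : C(X, ℝ)) (x : X) :
    dens μ x * Real.exp (φ x) ≤ Real.exp (μ.1 φ) := by
  have h := dens_le μ x φ
  rwa [Real.exp_sub, le_div_iff₀ (Real.exp_pos _)] at h

theorem exists_of_dens_lt {μ : IdempMeas X} {x : X} {c : ℝ} (h : dens μ x < c) :
    ∃ φ : C(X, ℝ), Real.exp (μ.1 φ - φ x) < c :=
  exists_lt_of_ciInf_lt h

/-- A density bound with a test function normalised at the point. -/
theorem exists_normalised_of_dens_lt {μ : IdempMeas X} {x : X} {c : ℝ} (h : dens μ x < c) :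
    ∃ φ : C(X, ℝ), φ x = 0 ∧ Real.exp (μ.1 φ) < c := by
  obtain ⟨φ, hφ⟩ := exists_of_dens_lt h
  refine ⟨φ + ContinuousMap.const X (-φ x), by simp, ?_⟩
  rw [μ.2.2.1]
  simpa [sub_eq_add_neg] using hφ

theorem isOpen_dens_lt_prod (c : ℝ) :
    IsOpen {p : IdempMeas X × X | dens p.1 p.2 < c} := by
  rw [isOpen_iff_mem_nhds]
  rintro ⟨μ, x⟩ h
  obtain ⟨φ, hφ⟩ := exists_of_dens_lt h
  have hc : Continuous fun p : IdempMeas X × X => Real.exp (p.1.1 φ - φ p.2) := by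
    refine Real.continuous_exp.comp (Continuous.sub ?_ (φ.continuous.comp continuous_snd))
    exact (eval φ).continuous.comp continuous_fst
  filter_upwards [(isOpen_lt hc continuous_const).mem_nhds hφ] with p hp
  exact (dens_le _ _ φ).trans_lt hp

theorem isOpen_dens_lt (μ : IdempMeas X) (c : ℝ) : IsOpen {x | dens μ x < c} :=
  (isOpen_dens_lt_prod c).preimage (Continuous.prodMk_right μ)

theorem isClosed_le_dens (μ : IdempMeas X) (c : ℝ) : IsClosed {x | c ≤ dens μ x} := by
  have := (isOpen_dens_lt μ c).isClosed_compl
  convert this using 1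
  ext x; simp

variable [CompactSpace X]

theorem exists_dens_mul_exp_eq (μ : IdempMeas X) (φ : C(X, ℝ)) :
    ∃ x, dens μ x * Real.exp (φ x) = Real.exp (μ.1 φ) := by
  by_contra! hne
  have hlt : ∀ x, dens μ x < Real.exp (μ.1 φ - φ x) := fun x => by
    rw [Real.exp_sub, lt_div_iff₀ (Real.exp_pos _)]
    exact lt_of_le_of_ne (dens_mul_exp_le μ φ x) (hne x)
  have key : ∃ χ : C(X, ℝ), μ.1 χ < μ.1 φ ∧ ∀ x ∈ (Set.univ : Set X), φ x < χ x := by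
    refine isCompact_univ.induction_on
      (p := fun S => ∃ χ : C(X, ℝ), μ.1 χ < μ.1 φ ∧ ∀ x ∈ S, φ x < χ x) ?_ ?_ ?_ ?_
    · exact ⟨ContinuousMap.const X (μ.1 φ - 1), by rw [μ.2.1]; linarith, by simp⟩
    · rintro s t hst ⟨χ, h1, h2⟩
      exact ⟨χ, h1, fun x hx => h2 x (hst hx)⟩
    · rintro s t ⟨χ, h1, h2⟩ ⟨χ', h1', h2'⟩
      refine ⟨χ ⊔ χ', by rw [μ.2.2.2]; exact max_lt h1 h1', ?_⟩
      rintro x (hx | hx)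
      · exact lt_of_lt_of_le (h2 x hx) (le_max_left _ _)
      · exact lt_of_lt_of_le (h2' x hx) (le_max_right _ _)
    · intro x _
      obtain ⟨χ, hχ⟩ := exists_of_dens_lt (hlt x)
      rw [Real.exp_lt_exp] at hχ
      -- Shifting by c puts χ strictly above φ at x, hence near x, while its value stays below that
      -- of φ; finite maxima of such functions contradict monotonicity.
      obtain ⟨c, hc1, hc2⟩ := exists_between (show φ x - χ x < μ.1 φ - μ.1 χ by linarith)
      refine ⟨{y | φ y < (χ + ContinuousMap.const X c) y},
        mem_nhdsWithin_of_mem_nhds ?_, χ + ContinuousMap.const X c, ?_, fun y hy => hy⟩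
      · refine (isOpen_lt φ.continuous (χ + ContinuousMap.const X c).continuous).mem_nhds ?_
        simp only [Set.mem_ofPred_eq, ContinuousMap.add_apply, ContinuousMap.const_apply]
        linarith
      · rw [μ.2.2.1]; linarith
  obtain ⟨χ, h1, h2⟩ := key
  exact absurd (μ.mono (φ := φ) (χ := χ) fun x => (h2 x trivial).le) (not_le.2 h1)

theorem exp_apply_le {μ : IdempMeas X} {φ : C(X, ℝ)} {c : ℝ}
    (h : ∀ x, dens μ x * Real.exp (φ x) ≤ c) : Real.exp (μ.1 φ) ≤ c := by
  obtain ⟨x, hx⟩ := exists_dens_mul_exp_eq μ φ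
  exact hx ▸ h x

theorem exists_dens_eq_one (μ : IdempMeas X) : ∃ x, dens μ x = 1 := by
  obtain ⟨x, hx⟩ := exists_dens_mul_exp_eq μ 0
  exact ⟨x, by simpa [apply_zero] using hx⟩

theorem apply_eq_of_eqOn {μ : IdempMeas X} {φ χ : C(X, ℝ)}
    (h : ∀ x, 0 < dens μ x → φ x = χ x) : μ.1 φ = μ.1 χ := by
  have key : ∀ φ χ : C(X, ℝ), (∀ x, 0 < dens μ x → φ x = χ x) → μ.1 φ ≤ μ.1 χ := by
    intro φ χ h
    rw [← Real.exp_le_exp]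
    refine exp_apply_le fun x => ?_
    rcases (dens_nonneg μ x).eq_or_lt with h0 | h0
    · rw [← h0, zero_mul]; exact (Real.exp_pos _).le
    · rw [h x h0]; exact dens_mul_exp_le μ χ x
  exact le_antisymm (key _ _ h) (key _ _ fun x hx => (h x hx).symm)

theorem apply_le_of_dens_le {μ ν : IdempMeas X} (h : ∀ x, dens μ x ≤ dens ν x) (φ : C(X, ℝ)) :
    μ.1 φ ≤ ν.1 φ := by
  rw [← Real.exp_le_exp]
  exact exp_apply_le fun x =>
    (mul_le_mul_of_nonneg_right (h x) (Real.exp_pos _).le).trans (dens_mul_exp_le ν φ x)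

theorem ext_dens {μ ν : IdempMeas X} (h : ∀ x, dens μ x = dens ν x) : μ = ν :=
  Subtype.ext <| funext fun φ => le_antisymm (apply_le_of_dens_le (fun x => (h x).le) φ)
    (apply_le_of_dens_le (fun x => (h x).ge) φ)

end Density

/-! ### Idempotent mixtures, the source of all measures constructed below. -/

section Mix

variable {X : Type u} [TopologicalSpace X] [CompactSpace X] {Z : Type u}

theorem mix_bddAbove {w : Z → ℝ} (k : Z → IdempMeas X) (h1 : ∀ z, w z ≤ 1) (φ : C(X, ℝ)) :
    BddAbove (Set.range fun z => w z * Real.exp ((k z).1 φ)) := by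
  refine ⟨Real.exp ‖φ‖, ?_⟩
  rintro _ ⟨z, rfl⟩
  calc w z * Real.exp ((k z).1 φ) ≤ 1 * Real.exp ‖φ‖ :=
        mul_le_mul (h1 z) (Real.exp_le_exp.2 ((le_abs_self _).trans ((k z).abs_apply_le φ)))
          (Real.exp_pos _).le zero_le_one
    _ = _ := one_mul _

theorem mix_pos {w : Z → ℝ} (k : Z → IdempMeas X) (h1 : ∀ z, w z ≤ 1) (hz : ∃ z, w z = 1)
    (φ : C(X, ℝ)) : 0 < ⨆ z, w z * Real.exp ((k z).1 φ) := by
  obtain ⟨z, hz⟩ := hz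
  refine lt_of_lt_of_le ?_ (le_ciSup (mix_bddAbove k h1 φ) z)
  simp only [hz, one_mul]
  exact Real.exp_pos _

/-- The idempotent mixture of a family of idempotent measures with weights `w`. -/
def mix (w : Z → ℝ) (k : Z → IdempMeas X) (h0 : ∀ z, 0 ≤ w z) (h1 : ∀ z, w z ≤ 1)
    (hz : ∃ z, w z = 1) : IdempMeas X :=
  haveI : Nonempty Z := ⟨hz.choose⟩
  ⟨fun φ => Real.log (⨆ z, w z * Real.exp ((k z).1 φ)), by
    intro c
    have h : (⨆ z, w z * Real.exp ((k z).1 (ContinuousMap.const X c))) = Real.exp c := by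
      obtain ⟨z, hz⟩ := hz
      apply le_antisymm
      · refine ciSup_le fun z => ?_
        rw [(k z).2.1]
        exact mul_le_of_le_one_left (Real.exp_pos _).le (h1 z)
      · refine le_ciSup_of_le (mix_bddAbove k h1 _) z ?_
        rw [(k z).2.1, hz, one_mul]
    simp only [h, Real.log_exp], by
    intro c φ
    have h : (⨆ z, w z * Real.exp ((k z).1 (φ + ContinuousMap.const X c)))
        = (⨆ z, w z * Real.exp ((k z).1 φ)) * Real.exp c := by
      rw [Real.iSup_mul_of_nonneg (Real.exp_pos c).le]
      refine iSup_congr fun z => ?_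
      rw [(k z).2.2.1, Real.exp_add, mul_assoc]
    simp only [h]
    rw [Real.log_mul (mix_pos k h1 hz φ).ne' (Real.exp_pos c).ne', Real.log_exp], by
    intro φ χ
    have h : (⨆ z, w z * Real.exp ((k z).1 (φ ⊔ χ)))
        = max (⨆ z, w z * Real.exp ((k z).1 φ)) (⨆ z, w z * Real.exp ((k z).1 χ)) := by
      have e : ∀ z, w z * Real.exp ((k z).1 (φ ⊔ χ))
          = max (w z * Real.exp ((k z).1 φ)) (w z * Real.exp ((k z).1 χ)) := fun z => by
        rw [(k z).2.2.2, Real.exp_monotone.map_max, mul_max_of_nonneg _ _ (h0 z)]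
      simp only [e]
      exact ciSup_sup_eq (mix_bddAbove k h1 φ) (mix_bddAbove k h1 χ)
    have hp := mix_pos k h1 hz φ
    have hq := mix_pos k h1 hz χ
    simp only [h]
    exact Real.strictMonoOn_log.monotoneOn.map_max hp hq⟩

variable {w : Z → ℝ} {k : Z → IdempMeas X} {h0 : ∀ z, 0 ≤ w z} {h1 : ∀ z, w z ≤ 1}
  {hz : ∃ z, w z = 1}

theorem exp_mix (φ : C(X, ℝ)) :
    Real.exp ((mix w k h0 h1 hz).1 φ) = ⨆ z, w z * Real.exp ((k z).1 φ) :=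
  Real.exp_log (mix_pos k h1 hz φ)

theorem le_exp_mix (φ : C(X, ℝ)) (z : Z) :
    w z * Real.exp ((k z).1 φ) ≤ Real.exp ((mix w k h0 h1 hz).1 φ) := by
  rw [exp_mix]
  exact le_ciSup (mix_bddAbove k h1 φ) z

theorem exp_mix_le {φ : C(X, ℝ)} {c : ℝ} (h : ∀ z, w z * Real.exp ((k z).1 φ) ≤ c) :
    Real.exp ((mix w k h0 h1 hz).1 φ) ≤ c := by
  have : Nonempty Z := ⟨hz.choose⟩
  rw [exp_mix]
  exact ciSup_le h

/-- Serves to identify images of mixtures: a push-forward of a mixture evaluates the mixture at a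
composed function, so it suffices that the target value bounds all terms and is reached by one. -/
theorem mix_apply_eq {Y : Type u} [TopologicalSpace Y] {ν : IdempMeas Y} {φ : C(X, ℝ)}
    {χ : C(Y, ℝ)} (h0 : ∀ z, 0 ≤ w z) (h1 : ∀ z, w z ≤ 1) (hz : ∃ z, w z = 1)
    (hle : ∀ z, w z * Real.exp ((k z).1 φ) ≤ Real.exp (ν.1 χ))
    (hex : ∃ z, Real.exp (ν.1 χ) ≤ w z * Real.exp ((k z).1 φ)) :
    (mix w k h0 h1 hz).1 φ = ν.1 χ := by
  apply Real.exp_injective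
  obtain ⟨z, hz'⟩ := hex
  exact le_antisymm (exp_mix_le hle) (hz'.trans (le_exp_mix φ z))

end Mix

/-! ### Densities of mixtures. -/

section DensityOfMix

variable {X Z : Type u} [TopologicalSpace X] [TopologicalSpace Z] [CompactSpace Z]
  {w : Z → ℝ} {k : Z → IdempMeas X} {μ : IdempMeas X}

/-- Formulated through inequalities on μ instead of `mix`, so that push-forwards (components `dirac
(f x)`) and joins (components all measures, weights `dens M`) are instances. -/
theorem mul_dens_le_dens (h0 : ∀ z, 0 ≤ w z)
    (hle : ∀ φ z, w z * Real.exp ((k z).1 φ) ≤ Real.exp (μ.1 φ)) (z : Z) (x : X) :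
    w z * dens (k z) x ≤ dens μ x := by
  refine le_ciInf fun φ => ?_
  calc w z * dens (k z) x ≤ w z * Real.exp ((k z).1 φ - φ x) :=
        mul_le_mul_of_nonneg_left (dens_le _ _ φ) (h0 z)
    _ = w z * Real.exp ((k z).1 φ) / Real.exp (φ x) := by rw [Real.exp_sub, mul_div_assoc]
    _ ≤ Real.exp (μ.1 φ) / Real.exp (φ x) := by gcongr; exact hle φ z
    _ = _ := (Real.exp_sub _ _).symm

/-- The density of a mixture over a compact space is attained by one of its components. -/
theorem exists_dens_eq_mul (h0 : ∀ z, 0 ≤ w z) (hw : ∀ c, IsOpen {z | w z < c})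
    (hk : Continuous k)
    (hle : ∀ φ z, w z * Real.exp ((k z).1 φ) ≤ Real.exp (μ.1 φ))
    (hge : ∀ φ c, (∀ z, w z * Real.exp ((k z).1 φ) ≤ c) → Real.exp (μ.1 φ) ≤ c) (x : X) :
    ∃ z, dens μ x = w z * dens (k z) x := by
  by_contra! hne
  have hlt : ∀ z, w z * dens (k z) x < dens μ x := fun z =>
    lt_of_le_of_ne (mul_dens_le_dens h0 hle z x) (hne z).symm
  have key : ∃ φ : C(X, ℝ), ∃ c < dens μ x, φ x = 0 ∧
      ∀ z ∈ (Set.univ : Set Z), w z * Real.exp ((k z).1 φ) ≤ c := by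
    refine isCompact_univ.induction_on
      (p := fun S => ∃ φ : C(X, ℝ), ∃ c < dens μ x, φ x = 0 ∧
        ∀ z ∈ S, w z * Real.exp ((k z).1 φ) ≤ c) ?_ ?_ ?_ ?_
    · exact ⟨0, dens μ x - 1, by linarith, rfl, by simp⟩
    · rintro s t hst ⟨φ, c, hc, hx, h⟩
      exact ⟨φ, c, hc, hx, fun z hz => h z (hst hz)⟩
    · rintro s t ⟨φ, c, hc, hx, h⟩ ⟨φ', c', hc', hx', h'⟩
      -- The minimum keeps the value 0 at x and lowers every component, so the local test functions
      -- can be combined.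
      refine ⟨φ ⊓ φ', max c c', max_lt hc hc', by simp [hx, hx'], ?_⟩
      rintro z (hz | hz)
      · exact ((mul_le_mul_of_nonneg_left (Real.exp_le_exp.2 ((k z).mono inf_le_left))
          (h0 z)).trans (h z hz)).trans (le_max_left _ _)
      · exact ((mul_le_mul_of_nonneg_left (Real.exp_le_exp.2 ((k z).mono inf_le_right))
          (h0 z)).trans (h' z hz)).trans (le_max_right _ _)
    · intro z _
      obtain ⟨φ, hφx, hφ⟩ : ∃ φ : C(X, ℝ), φ x = 0 ∧
          w z * Real.exp ((k z).1 φ) < dens μ x := by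
        rcases (h0 z).eq_or_lt with hz | hz
        · refine ⟨0, rfl, ?_⟩
          have := hlt z
          rwa [← hz, zero_mul] at this ⊢
        · have := hlt z
          rw [mul_comm, ← lt_div_iff₀ hz] at this
          obtain ⟨φ, hφx, hφ⟩ := exists_normalised_of_dens_lt this
          refine ⟨φ, hφx, ?_⟩
          rwa [mul_comm, ← lt_div_iff₀ hz]
      obtain ⟨c, hc1, hc2⟩ := exists_between hφ
      rw [← lt_div_iff₀ (Real.exp_pos _)] at hc1
      -- The weight is only upper semicontinuous. The number r separates it from the continuous
      -- factor c / exp, so both strict inequalities persist near z.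
      obtain ⟨r, hr1, hr2⟩ := exists_between hc1
      have hcont : Continuous fun z => c / Real.exp ((k z).1 φ) :=
        continuous_const.div (Real.continuous_exp.comp ((eval φ).continuous.comp hk))
          fun _ => (Real.exp_pos _).ne'
      refine ⟨{z | w z < r} ∩ {z | r < c / Real.exp ((k z).1 φ)},
        mem_nhdsWithin_of_mem_nhds (((hw r).inter
          (isOpen_lt continuous_const hcont)).mem_nhds ⟨hr1, hr2⟩), φ, c, hc2, hφx, ?_⟩
      rintro z' ⟨hz1, hz2⟩
      rw [← le_div_iff₀ (Real.exp_pos _)]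
      exact (lt_trans hz1 hz2).le
  obtain ⟨φ, c, hc, hx, h⟩ := key
  have h2 := dens_le μ x φ
  rw [hx, sub_zero] at h2
  exact absurd (h2.trans (hge φ c fun z => h z trivial)) (not_le.2 hc)

end DensityOfMix

/-! ### Densities of Dirac measures, push-forwards and joins. -/

section DensityOfFunctor

variable {X Y : Type u} [TopologicalSpace X] [CompactSpace X] [T2Space X]
  [TopologicalSpace Y] [CompactSpace Y] [T2Space Y]

theorem dens_eq_zero_of_eqOn {μ : IdempMeas X} {A : Set X} (hA : IsClosed A)
    (h : ∀ φ χ : C(X, ℝ), Set.EqOn φ χ A → μ.1 φ = μ.1 χ) {x : X} (hx : x ∉ A) :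
    dens μ x = 0 := by
  obtain ⟨g, hg0, hg1, -⟩ := exists_continuous_zero_one_of_isClosed hA
    (isClosed_singleton (x := x)) (Set.disjoint_singleton_right.2 hx)
  have hgx : g x = 1 := hg1 rfl
  refine le_antisymm (le_of_forall_pos_le_add fun ε hε => ?_) (dens_nonneg _ _)
  -- This Urysohn function vanishes on A, so μ gives it the value 0; at x it equals −log ε, which
  -- bounds the density by ε.
  have h1 := h ((-Real.log ε) • g) 0 fun y hy => by simp [hg0 hy]
  have h2 := dens_le μ x ((-Real.log ε) • g)
  rw [h1, apply_zero] at h2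
  simpa [hgx, Real.exp_log hε] using h2

theorem dens_dirac_self (x : X) : dens (dirac x) x = 1 := by
  have h : ∀ φ : C(X, ℝ), Real.exp ((dirac x).1 φ - φ x) = 1 := fun φ => by simp [dirac]
  simp [dens, h]

theorem dens_dirac_of_ne {x y : X} (h : x ≠ y) : dens (dirac y) x = 0 :=
  dens_eq_zero_of_eqOn (isClosed_singleton (x := y)) (fun _ _ hφ => hφ rfl) h

theorem eq_of_dens_dirac_pos {x y : X} (h : 0 < dens (dirac y) x) : x = y := by
  by_contra hne
  rw [dens_dirac_of_ne hne] at h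
  exact lt_irrefl _ h

theorem dens_le_dens_map (f : C(X, Y)) (μ : IdempMeas X) (x : X) :
    dens μ x ≤ dens (map f μ) (f x) := by
  have := mul_dens_le_dens (w := dens μ) (k := fun x => dirac (f x)) (μ := map f μ)
    (dens_nonneg μ) (fun φ z => dens_mul_exp_le μ (φ.comp f) z) x (f x)
  rwa [dens_dirac_self, mul_one] at this

theorem exists_dens_map_eq (f : C(X, Y)) (μ : IdempMeas X) {y : Y}
    (hy : 0 < dens (map f μ) y) : ∃ x, f x = y ∧ dens μ x = dens (map f μ) y := by
  obtain ⟨x, hx⟩ := exists_dens_eq_mul (w := dens μ) (k := fun x => dirac (f x))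
    (μ := map f μ) (dens_nonneg μ) (isOpen_dens_lt μ) (continuous_dirac.comp f.continuous)
    (fun φ z => dens_mul_exp_le μ (φ.comp f) z)
    (fun φ c h => exp_apply_le (φ := φ.comp f) h) y
  have hxy : y = f x := eq_of_dens_dirac_pos <| by
    by_contra h0
    have h0' := le_antisymm (not_lt.1 h0) (dens_nonneg _ _)
    rw [h0', mul_zero] at hx
    exact hy.ne' hx
  refine ⟨x, hxy.symm, ?_⟩
  rw [hx, hxy, dens_dirac_self, mul_one]

theorem dens_map_of_injective {f : C(X, Y)} (hf : Function.Injective f) (μ : IdempMeas X)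
    (x : X) : dens (map f μ) (f x) = dens μ x := by
  refine le_antisymm ?_ (dens_le_dens_map f μ x)
  rcases (dens_nonneg (map f μ) (f x)).eq_or_lt with h | h
  · rw [← h]; exact dens_nonneg _ _
  · obtain ⟨x', hx', h'⟩ := exists_dens_map_eq f μ h
    rw [← h', hf hx']

theorem map_injective {f : C(X, Y)} (hf : Function.Injective f) :
    Function.Injective (map f) := fun μ ν h =>
  ext_dens fun x => by rw [← dens_map_of_injective hf, h, dens_map_of_injective hf]

/-- A preimage is obtained by pulling the density back: mix the Dirac measures on X with weights
`dens ν (f x)`. This characterisation drives the treatment of supports, intersections and lifting of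
couplings. -/
theorem exists_map_eq_iff {f : C(X, Y)} {ν : IdempMeas Y} :
    (∃ μ, map f μ = ν) ↔ ∀ y, 0 < dens ν y → y ∈ Set.range f := by
  constructor
  · rintro ⟨μ, rfl⟩ y hy
    obtain ⟨x, hx, -⟩ := exists_dens_map_eq f μ hy
    exact ⟨x, hx⟩
  · intro h
    have hz : ∃ x, dens ν (f x) = 1 := by
      obtain ⟨y, hy⟩ := exists_dens_eq_one ν
      obtain ⟨x, rfl⟩ := h y (by rw [hy]; exact one_pos)
      exact ⟨x, hy⟩
    refine ⟨mix (fun x => dens ν (f x)) dirac (fun _ => dens_nonneg _ _)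
      (fun _ => dens_le_one _ _) hz, Subtype.ext (funext fun φ => ?_)⟩
    refine mix_apply_eq (φ := φ.comp f) (fun _ => dens_nonneg _ _)
      (fun _ => dens_le_one _ _) hz (fun x => dens_mul_exp_le ν φ (f x)) ?_
    obtain ⟨y, hy⟩ := exists_dens_mul_exp_eq ν φ
    have hpos : 0 < dens ν y := by
      by_contra h0
      have h0' := le_antisymm (not_lt.1 h0) (dens_nonneg _ _)
      rw [h0', zero_mul] at hy
      exact (Real.exp_pos _).ne hy
    obtain ⟨x, rfl⟩ := h y hpos
    exact ⟨x, hy.ge⟩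

theorem dens_mul_dens_le_dens_join (M : IdempMeas (IdempMeas X)) (μ : IdempMeas X) (x : X) :
    dens M μ * dens μ x ≤ dens (join M) x :=
  mul_dens_le_dens (w := dens M) (k := id) (μ := join M) (dens_nonneg M)
    (fun φ z => dens_mul_exp_le M (eval φ) z) μ x

theorem exists_dens_join_eq (M : IdempMeas (IdempMeas X)) (x : X) :
    ∃ μ, dens (join M) x = dens M μ * dens μ x :=
  exists_dens_eq_mul (w := dens M) (k := id) (μ := join M) (dens_nonneg M)
    (isOpen_dens_lt M) continuous_id (fun φ z => dens_mul_exp_le M (eval φ) z)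
    (fun φ _ h => exp_apply_le (φ := eval φ) h) x

end DensityOfFunctor

end IdempMeas

namespace IdempMeas

/-! ### Supports. -/

section Support

variable {X Y : Type u} [TopologicalSpace X] [CompactSpace X] [T2Space X]
  [TopologicalSpace Y] [CompactSpace Y] [T2Space Y]

theorem exists_map_subtype_val_eq_iff {μ : IdempMeas X} {A : Set X} (hA : IsClosed A) :
    (∃ ν : IdempMeas A, map ⟨Subtype.val, continuous_subtype_val⟩ ν = μ) ↔
      {x | 0 < dens μ x} ⊆ A := by
  have : CompactSpace A := isCompact_iff_compactSpace.1 hA.isCompact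
  rw [exists_map_eq_iff]
  simp [Set.subset_def]

theorem supp_eq_closure (μ : IdempMeas X) : supp μ = closure {x | 0 < dens μ x} := by
  apply Set.Subset.antisymm
  · exact Set.sInter_subset_of_mem
      ⟨isClosed_closure, (exists_map_subtype_val_eq_iff isClosed_closure).2 subset_closure⟩
  · refine closure_minimal ?_ (isClosed_sInter fun A hA => hA.1)
    rintro x hx A ⟨hA, h⟩
    exact (exists_map_subtype_val_eq_iff hA).1 h hx

theorem mem_supp_of_dens_pos {μ : IdempMeas X} {x : X} (h : 0 < dens μ x) : x ∈ supp μ := by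
  rw [supp_eq_closure]; exact subset_closure h

theorem supp_subset_iff {μ : IdempMeas X} {A : Set X} (hA : IsClosed A) :
    supp μ ⊆ A ↔ ∀ x, 0 < dens μ x → x ∈ A := by
  rw [supp_eq_closure, hA.closure_subset_iff]; rfl

theorem exists_mem_supp_dens_eq_one (μ : IdempMeas X) : ∃ x ∈ supp μ, dens μ x = 1 := by
  obtain ⟨x, hx⟩ := exists_dens_eq_one μ
  exact ⟨x, mem_supp_of_dens_pos (hx ▸ one_pos), hx⟩

theorem supp_nonempty (μ : IdempMeas X) : (supp μ).Nonempty :=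
  let ⟨x, hx, _⟩ := exists_mem_supp_dens_eq_one μ
  ⟨x, hx⟩

theorem supp_map (f : C(X, Y)) (μ : IdempMeas X) : supp (map f μ) = f '' supp μ := by
  rw [supp_eq_closure, supp_eq_closure,
    ← f.continuous.isClosedMap.closure_image_eq_of_continuous f.continuous]
  congr 1
  ext y
  constructor
  · intro hy
    obtain ⟨x, rfl, hx⟩ := exists_dens_map_eq f μ hy
    refine ⟨x, ?_, rfl⟩
    change 0 < dens μ x
    rw [hx]; exact hy
  · rintro ⟨x, hx, rfl⟩
    exact lt_of_lt_of_le hx (dens_le_dens_map f μ x)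

theorem supp_dirac (x : X) : supp (dirac x) = {x} := by
  apply Set.Subset.antisymm
  · rw [supp_subset_iff isClosed_singleton]
    exact fun y hy => eq_of_dens_dirac_pos hy
  · rintro _ rfl
    exact mem_supp_of_dens_pos (by rw [dens_dirac_self]; exact one_pos)

/-- The support of `join M` contains the supports of all measures in the support of `M`. -/
theorem supp_subset_supp_join {M : IdempMeas (IdempMeas X)} {μ : IdempMeas X}
    (hμ : μ ∈ supp M) : supp μ ⊆ supp (join M) := by
  set A := supp (join M) with hA
  have hAc : IsClosed A := by rw [hA, supp_eq_closure]; exact isClosed_closure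
  have : CompactSpace A := isCompact_iff_compactSpace.1 hAc.isCompact
  -- I(A) is compact, hence closed in I(X); therefore only measures of positive density under M have
  -- to be checked.
  have hcl : IsClosed (Set.range (map (⟨Subtype.val, continuous_subtype_val⟩ : C(A, X)))) :=
    (isCompact_range (continuous_map _)).isClosed
  have h := (supp_subset_iff (μ := M) hcl).2 (fun ν hν => by
    refine (exists_map_subtype_val_eq_iff hAc).2 fun x hx => ?_
    exact mem_supp_of_dens_pos
      (lt_of_lt_of_le (mul_pos hν hx) (dens_mul_dens_le_dens_join M ν x)))
  exact (supp_subset_iff hAc).2 ((exists_map_subtype_val_eq_iff hAc).1 (h hμ))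

end Support

/-! ### Couplings and the transport distance. -/

section Coupling

variable {X : Type u} [TopologicalSpace X] [CompactSpace X] [T2Space X]

/-- The idempotent product, with weights `dens μ x * dens ν y`, is a coupling: maximising over the
other coordinate gives the factor 1. -/
theorem admissible_nonempty (μ ν : IdempMeas X) : (admissible μ ν).Nonempty := by
  obtain ⟨x₀, hx₀⟩ := exists_dens_eq_one μ
  obtain ⟨y₀, hy₀⟩ := exists_dens_eq_one ν
  have h0 : ∀ p : X × X, 0 ≤ dens μ p.1 * dens ν p.2 := fun p =>
    mul_nonneg (dens_nonneg _ _) (dens_nonneg _ _)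
  have h1 : ∀ p : X × X, dens μ p.1 * dens ν p.2 ≤ 1 := fun p =>
    mul_le_one₀ (dens_le_one _ _) (dens_nonneg _ _) (dens_le_one _ _)
  have hz : ∃ p : X × X, dens μ p.1 * dens ν p.2 = 1 := ⟨(x₀, y₀), by simp [hx₀, hy₀]⟩
  refine ⟨mix (fun p : X × X => dens μ p.1 * dens ν p.2) dirac h0 h1 hz,
    Subtype.ext (funext fun φ => ?_), Subtype.ext (funext fun φ => ?_)⟩
  · refine mix_apply_eq (φ := φ.comp ContinuousMap.fst) h0 h1 hz (fun p => ?_) ?_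
    · refine le_trans ?_ (dens_mul_exp_le μ φ p.1)
      exact mul_le_mul_of_nonneg_right
        (mul_le_of_le_one_right (dens_nonneg _ _) (dens_le_one _ _)) (Real.exp_pos _).le
    · obtain ⟨x, hx⟩ := exists_dens_mul_exp_eq μ φ
      refine ⟨(x, y₀), ?_⟩
      simp only [hy₀, mul_one]
      exact hx.ge
  · refine mix_apply_eq (φ := φ.comp ContinuousMap.snd) h0 h1 hz (fun p => ?_) ?_
    · refine le_trans ?_ (dens_mul_exp_le ν φ p.2)
      exact mul_le_mul_of_nonneg_right
        (mul_le_of_le_one_left (dens_nonneg _ _) (dens_le_one _ _)) (Real.exp_pos _).le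
    · obtain ⟨x, hx⟩ := exists_dens_mul_exp_eq ν φ
      refine ⟨(x₀, x), ?_⟩
      simp only [hx₀, one_mul]
      exact hx.ge

/-- Positive density forces the second coordinate to be y, so the coupling with a Dirac measure is
unique. Transport distances to Dirac measures thereby become suprema over a support. -/
theorem eq_map_of_mem_admissible_dirac_right {μ : IdempMeas X} {y : X}
    {ξ : IdempMeas (X × X)} (h : ξ ∈ admissible μ (dirac y)) :
    ξ = map ((ContinuousMap.id X).prodMk (ContinuousMap.const X y)) μ := by
  obtain ⟨h1, h2⟩ := h
  refine Subtype.ext (funext fun φ => ?_)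
  rw [← h1]
  refine apply_eq_of_eqOn fun p hp => ?_
  have h3 := lt_of_lt_of_le hp (dens_le_dens_map ContinuousMap.snd ξ p)
  rw [h2] at h3
  have h4 : p.2 = y := eq_of_dens_dirac_pos h3
  rw [← h4]; rfl

theorem eq_map_of_mem_admissible_dirac_left {ν : IdempMeas X} {x : X}
    {ξ : IdempMeas (X × X)} (h : ξ ∈ admissible (dirac x) ν) :
    ξ = map ((ContinuousMap.const X x).prodMk (ContinuousMap.id X)) ν := by
  obtain ⟨h1, h2⟩ := h
  refine Subtype.ext (funext fun φ => ?_)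
  rw [← h2]
  refine apply_eq_of_eqOn fun p hp => ?_
  have h3 := lt_of_lt_of_le hp (dens_le_dens_map ContinuousMap.fst ξ p)
  rw [h1] at h3
  have h4 : p.1 = x := eq_of_dens_dirac_pos h3
  rw [← h4]; rfl

variable {d : X → X → ℝ} {B : ℝ} (h0 : ∀ x y, 0 ≤ d x y) (hB : ∀ x y, d x y ≤ B)

include h0 in
theorem transportDist_nonneg (μ ν : IdempMeas X) : 0 ≤ transportDist d μ ν := by
  refine Real.sInf_nonneg ?_
  rintro _ ⟨ξ, -, rfl⟩
  refine Real.sSup_nonneg ?_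
  rintro _ ⟨p, -, rfl⟩
  exact h0 _ _

include h0 in
theorem transportDist_le {μ ν : IdempMeas X} {ξ : IdempMeas (X × X)} (hξ : ξ ∈ admissible μ ν)
    {c : ℝ} (hc : ∀ p ∈ supp ξ, d p.1 p.2 ≤ c) : transportDist d μ ν ≤ c := by
  refine (csInf_le ⟨0, ?_⟩ (Set.mem_image_of_mem _ hξ)).trans (csSup_le ((supp_nonempty ξ).image _) ?_)
  · rintro _ ⟨ξ, -, rfl⟩
    refine Real.sSup_nonneg ?_
    rintro _ ⟨p, -, rfl⟩
    exact h0 _ _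
  · rintro _ ⟨p, hp, rfl⟩
    exact hc p hp

include h0 hB in
theorem transportDist_le_bound (μ ν : IdempMeas X) : transportDist d μ ν ≤ B :=
  let ⟨_, hξ⟩ := admissible_nonempty μ ν
  transportDist_le h0 hξ fun _ _ => hB _ _

include hB in
theorem exists_of_transportDist_lt {μ ν : IdempMeas X} {c : ℝ} (h : transportDist d μ ν < c) :
    ∃ ξ ∈ admissible μ ν, ∃ c' < c, ∀ p ∈ supp ξ, d p.1 p.2 ≤ c' := by
  obtain ⟨_, ⟨ξ, hξ, rfl⟩, h⟩ := exists_lt_of_csInf_lt ((admissible_nonempty μ ν).image _) h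
  refine ⟨ξ, hξ, _, h, fun p hp => le_csSup ⟨B, ?_⟩ ⟨p, hp, rfl⟩⟩
  rintro _ ⟨p, -, rfl⟩
  exact hB _ _

include h0 hB in
theorem transportDist_dirac_right_le_iff {μ : IdempMeas X} {y : X} {c : ℝ} :
    transportDist d μ (dirac y) ≤ c ↔ ∀ x ∈ supp μ, d x y ≤ c := by
  constructor
  · intro h x hx
    refine le_of_forall_gt_imp_ge_of_dense fun c' hc' => ?_
    obtain ⟨ξ, hξ, c'', hc'', hs⟩ := exists_of_transportDist_lt hB (h.trans_lt hc')
    rw [eq_map_of_mem_admissible_dirac_right hξ, supp_map] at hs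
    exact (hs (x, y) ⟨x, hx, rfl⟩).trans hc''.le
  · intro h
    obtain ⟨ξ, hξ⟩ := admissible_nonempty μ (dirac y)
    refine transportDist_le h0 hξ ?_
    rw [eq_map_of_mem_admissible_dirac_right hξ, supp_map]
    rintro _ ⟨x, hx, rfl⟩
    exact h x hx

include h0 hB in
theorem transportDist_dirac_left_le_iff {ν : IdempMeas X} {x : X} {c : ℝ} :
    transportDist d (dirac x) ν ≤ c ↔ ∀ y ∈ supp ν, d x y ≤ c := by
  constructor
  · intro h y hy
    refine le_of_forall_gt_imp_ge_of_dense fun c' hc' => ?_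
    obtain ⟨ξ, hξ, c'', hc'', hs⟩ := exists_of_transportDist_lt hB (h.trans_lt hc')
    rw [eq_map_of_mem_admissible_dirac_left hξ, supp_map] at hs
    exact (hs (x, y) ⟨y, hy, rfl⟩).trans hc''.le
  · intro h
    obtain ⟨ξ, hξ⟩ := admissible_nonempty (dirac x) ν
    refine transportDist_le h0 hξ ?_
    rw [eq_map_of_mem_admissible_dirac_left hξ, supp_map]
    rintro _ ⟨y, hy, rfl⟩
    exact h y hy

include h0 hB in
theorem transportDist_dirac_dirac (x y : X) : transportDist d (dirac x) (dirac y) = d x y :=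
  eq_of_forall_ge_iff fun c => by
    rw [transportDist_dirac_right_le_iff h0 hB, supp_dirac]; simp

include h0 hB in
/-- If `μ` is far from all Dirac measures, then so is `I(δ)(μ)`. -/
theorem le_transportDist_map_dirac {ε : ℝ} {μ : IdempMeas X}
    (h : ∀ x, ε ≤ transportDist d μ (dirac x)) (ν : IdempMeas X) :
    ε ≤ transportDist (transportDist d) (map ⟨dirac, continuous_dirac⟩ μ) (dirac ν) := by
  -- Any y in the support of ν works: d(x, y) ≤ d₁(δ_x, ν) for every x in supp μ, and d₂ bounds the
  -- right side.
  obtain ⟨y, hy, -⟩ := exists_mem_supp_dens_eq_one ν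
  refine (h y).trans ((transportDist_dirac_right_le_iff h0 hB).2 fun x hx => ?_)
  have h1 := (transportDist_dirac_right_le_iff (transportDist_nonneg h0)
    (transportDist_le_bound h0 hB)).1
    (le_refl (transportDist (transportDist d) (map ⟨dirac, continuous_dirac⟩ μ) (dirac ν)))
    (dirac x) (by rw [supp_map]; exact ⟨x, hx, rfl⟩)
  exact (transportDist_dirac_left_le_iff h0 hB).1 h1 y hy

include h0 hB in
-- Gluing: choose a cheap coupling for each pair of measures charged by Ξ and mix these couplings
-- with the density of Ξ as weights.
theorem transportDist_join_le (hd : Continuous fun p : X × X => d p.1 p.2)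
    (M N : IdempMeas (IdempMeas X)) :
    transportDist d (join M) (join N) ≤ transportDist (transportDist d) M N := by
  refine le_of_forall_gt_imp_ge_of_dense fun c hc => ?_
  obtain ⟨Ξ, ⟨hM, hN⟩, c', hc', hΞ⟩ :=
    exists_of_transportDist_lt (transportDist_le_bound h0 hB) hc
  have hex : ∀ p : {p : IdempMeas X × IdempMeas X // 0 < dens Ξ p},
      ∃ ξ ∈ admissible p.1.1 p.1.2, ∀ q, 0 < dens ξ q → d q.1 q.2 ≤ c := fun p => by
    obtain ⟨ξ, hξ, c'', hc'', h⟩ := exists_of_transportDist_lt hB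
      ((hΞ _ (mem_supp_of_dens_pos p.2)).trans_lt hc')
    exact ⟨ξ, hξ, fun q hq => (h q (mem_supp_of_dens_pos hq)).trans hc''.le⟩
  choose k hk hkc using hex
  have w0 : ∀ p : {p : IdempMeas X × IdempMeas X // 0 < dens Ξ p}, 0 ≤ dens Ξ p.1 :=
    fun _ => dens_nonneg _ _
  have w1 : ∀ p : {p : IdempMeas X × IdempMeas X // 0 < dens Ξ p}, dens Ξ p.1 ≤ 1 :=
    fun _ => dens_le_one _ _
  have hz : ∃ p : {p : IdempMeas X × IdempMeas X // 0 < dens Ξ p}, dens Ξ p.1 = 1 :=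
    let ⟨p, hp⟩ := exists_dens_eq_one Ξ
    ⟨⟨p, hp ▸ one_pos⟩, hp⟩
  have hA : IsClosed {q : X × X | d q.1 q.2 ≤ c} := isClosed_le hd continuous_const
  refine transportDist_le (ξ := mix (fun p => dens Ξ p.1) k w0 w1 hz) h0 ⟨?_, ?_⟩ ?_
  · refine Subtype.ext (funext fun φ => ?_)
    refine mix_apply_eq (φ := φ.comp ContinuousMap.fst) w0 w1 hz (fun p => ?_) ?_
    · have e : (k p).1 (φ.comp ContinuousMap.fst) = p.1.1.1 φ :=
        congrFun (congrArg Subtype.val (hk p).1) φ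
      rw [e, ← hM]
      exact dens_mul_exp_le Ξ ((eval φ).comp ContinuousMap.fst) p.1
    · obtain ⟨p, hp⟩ := exists_dens_mul_exp_eq Ξ ((eval φ).comp ContinuousMap.fst)
      have hpos : 0 < dens Ξ p := by
        refine (dens_nonneg Ξ p).lt_of_ne fun h => ?_
        rw [← h, zero_mul] at hp
        exact (Real.exp_pos _).ne hp
      refine ⟨⟨p, hpos⟩, ?_⟩
      have e : (k ⟨p, hpos⟩).1 (φ.comp ContinuousMap.fst) = p.1.1 φ :=
        congrFun (congrArg Subtype.val (hk ⟨p, hpos⟩).1) φ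
      rw [e, ← hM]
      exact hp.ge
  · refine Subtype.ext (funext fun φ => ?_)
    refine mix_apply_eq (φ := φ.comp ContinuousMap.snd) w0 w1 hz (fun p => ?_) ?_
    · have e : (k p).1 (φ.comp ContinuousMap.snd) = p.1.2.1 φ :=
        congrFun (congrArg Subtype.val (hk p).2) φ
      rw [e, ← hN]
      exact dens_mul_exp_le Ξ ((eval φ).comp ContinuousMap.snd) p.1
    · obtain ⟨p, hp⟩ := exists_dens_mul_exp_eq Ξ ((eval φ).comp ContinuousMap.snd)
      have hpos : 0 < dens Ξ p := by
        refine (dens_nonneg Ξ p).lt_of_ne fun h => ?_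
        rw [← h, zero_mul] at hp
        exact (Real.exp_pos _).ne hp
      refine ⟨⟨p, hpos⟩, ?_⟩
      have e : (k ⟨p, hpos⟩).1 (φ.comp ContinuousMap.snd) = p.2.1 φ :=
        congrFun (congrArg Subtype.val (hk ⟨p, hpos⟩).2) φ
      rw [e, ← hN]
      exact hp.ge
  · refine (supp_subset_iff hA).2 fun q hq => ?_
    by_contra hqA
    refine hq.ne' (dens_eq_zero_of_eqOn hA (fun φ χ hφχ => ?_) hqA)
    -- Each component ignores values off the closed set {d ≤ c}, hence so does the mixture, and its
    -- density vanishes there.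
    refine congrArg Real.log (iSup_congr fun p => ?_)
    rw [apply_eq_of_eqOn fun x hx => hφχ (hkc p x hx)]

include h0 hB in
-- Both sides are suprema of d(·, x). Supports of measures in supp N lie in the support of the join,
-- and each point of positive density for the join has positive density for some μ charged by N.
theorem transportDist_join_dirac (hd : Continuous fun p : X × X => d p.1 p.2)
    (N : IdempMeas (IdempMeas X)) (x : X) :
    transportDist d (join N) (dirac x) =
      transportDist (transportDist d) N (dirac (dirac x)) := by
  refine eq_of_forall_ge_iff fun c => ?_
  rw [transportDist_dirac_right_le_iff h0 hB, transportDist_dirac_right_le_iff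
    (transportDist_nonneg h0) (transportDist_le_bound h0 hB)]
  simp only [transportDist_dirac_right_le_iff h0 hB]
  constructor
  · intro h μ hμ y hy
    exact h y (supp_subset_supp_join hμ hy)
  · intro h
    have hA : IsClosed {y : X | d y x ≤ c} :=
      isClosed_le (hd.comp (Continuous.prodMk_left x)) continuous_const
    refine (supp_subset_iff hA).2 fun y hy => ?_
    obtain ⟨μ, hμ⟩ := exists_dens_join_eq N y
    rw [hμ] at hy
    exact h μ (mem_supp_of_dens_pos
        ((dens_nonneg N μ).lt_of_ne (left_ne_zero_of_mul hy.ne').symm)) y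
      (mem_supp_of_dens_pos ((dens_nonneg μ y).lt_of_ne (right_ne_zero_of_mul hy.ne').symm))

end Coupling

/-! ### Transport distance under push-forward. -/

section CouplingMap

variable {X Y : Type u} [TopologicalSpace X] [CompactSpace X] [T2Space X]
  [TopologicalSpace Y] [CompactSpace Y] [T2Space Y]

theorem map_prodMap_mem_admissible (f : C(X, Y)) {μ ν : IdempMeas X} {ξ : IdempMeas (X × X)}
    (hξ : ξ ∈ admissible μ ν) : map (f.prodMap f) ξ ∈ admissible (map f μ) (map f ν) := by
  obtain ⟨h1, h2⟩ := hξ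
  constructor
  · rw [← h1]; rfl
  · rw [← h2]; rfl

/-- Uniform continuity bounds pass from `f` to `I(f)`. -/
theorem transportDist_map_le {d : X → X → ℝ} {d' : Y → Y → ℝ} {B : ℝ}
    (hB : ∀ x y, d x y ≤ B) (h0' : ∀ x y, 0 ≤ d' x y) (f : C(X, Y)) {δ ε : ℝ}
    (h : ∀ x y, d x y < δ → d' (f x) (f y) ≤ ε) {μ ν : IdempMeas X}
    (hμν : transportDist d μ ν < δ) : transportDist d' (map f μ) (map f ν) ≤ ε := by
  obtain ⟨ξ, hξ, c, hc, hs⟩ := exists_of_transportDist_lt hB hμν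
  refine transportDist_le h0' (map_prodMap_mem_admissible f hξ) ?_
  rw [supp_map]
  rintro _ ⟨p, hp, rfl⟩
  exact h _ _ ((hs p hp).trans_lt hc)

theorem transportDist_map_of_isometry {d : X → X → ℝ} {d' : Y → Y → ℝ} {B : ℝ}
    (h0 : ∀ x y, 0 ≤ d x y) (hB : ∀ x y, d x y ≤ B)
    (h0' : ∀ x y, 0 ≤ d' x y) (hB' : ∀ x y, d' x y ≤ B) (f : C(X, Y))
    (hf : Function.Injective f) (h : ∀ x y, d' (f x) (f y) = d x y) (μ ν : IdempMeas X) :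
    transportDist d' (map f μ) (map f ν) = transportDist d μ ν := by
  apply le_antisymm
  · refine le_of_forall_gt_imp_ge_of_dense fun c hc => ?_
    obtain ⟨ξ, hξ, c', hc', hs⟩ := exists_of_transportDist_lt hB hc
    refine transportDist_le h0' (map_prodMap_mem_admissible f hξ) ?_
    rw [supp_map]
    rintro _ ⟨p, hp, rfl⟩
    exact (h _ _).trans_le ((hs p hp).trans hc'.le)
  · refine le_of_forall_gt_imp_ge_of_dense fun c hc => ?_
    obtain ⟨ξ', ⟨h1, h2⟩, c', hc', hs⟩ := exists_of_transportDist_lt hB' hc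
    -- A coupling of the images has positive density only on f(X) × f(X), so it lifts along f × f;
    -- injectivity of I(f) then identifies the marginals.
    obtain ⟨ξ, rfl⟩ : ∃ ξ, map (f.prodMap f) ξ = ξ' := by
      refine exists_map_eq_iff.2 fun p hp => ?_
      have e1 := lt_of_lt_of_le hp (dens_le_dens_map ContinuousMap.fst ξ' p)
      have e2 := lt_of_lt_of_le hp (dens_le_dens_map ContinuousMap.snd ξ' p)
      rw [h1] at e1
      rw [h2] at e2
      obtain ⟨x, hx, -⟩ := exists_dens_map_eq f μ e1
      obtain ⟨y, hy, -⟩ := exists_dens_map_eq f ν e2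
      exact ⟨(x, y), Prod.ext hx hy⟩
    refine transportDist_le h0 (ξ := ξ) ⟨map_injective hf h1, map_injective hf h2⟩ ?_
    intro p hp
    rw [← h]
    refine (hs (f p.1, f p.2) ?_).trans hc'.le
    rw [supp_map]
    exact ⟨p, hp, rfl⟩

end CouplingMap

end IdempMeas

namespace IdempMeas

/-! ### The density distance. -/

section Dominates

variable {X Y : Type u} [TopologicalSpace X] [CompactSpace X] [T2Space X]
  [TopologicalSpace Y] [CompactSpace Y] [T2Space Y]

/-- The density of `μ` is matched by the density of `ν` at cost `r`. -/
def Dominates (d : X → X → ℝ) (r : ℝ) (μ ν : IdempMeas X) : Prop :=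
  ∀ x, ∃ y, dens μ x * Real.exp (d x y) ≤ dens ν y * Real.exp r ∧
    dens μ x * (Real.exp (d x y) - 1) ≤ dens ν y * (Real.exp r - 1)

/-- The Hausdorff type distance of idempotent measures defined by mutual domination. -/
def densDist (d : X → X → ℝ) (μ ν : IdempMeas X) : ℝ :=
  sInf {r | 0 ≤ r ∧ Dominates d r μ ν ∧ Dominates d r ν μ}

theorem exp_sub_one_nonneg {r : ℝ} (hr : 0 ≤ r) : 0 ≤ Real.exp r - 1 :=
  sub_nonneg.2 (Real.one_le_exp hr)

theorem Dominates.mono {d : X → X → ℝ} {r s : ℝ} {μ ν : IdempMeas X} (h : Dominates d r μ ν)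
    (hrs : r ≤ s) : Dominates d s μ ν := fun x => by
  obtain ⟨y, h1, h2⟩ := h x
  exact ⟨y, h1.trans (mul_le_mul_of_nonneg_left (Real.exp_le_exp.2 hrs) (dens_nonneg _ _)),
    h2.trans (mul_le_mul_of_nonneg_left (sub_le_sub_right (Real.exp_le_exp.2 hrs) 1)
      (dens_nonneg _ _))⟩

theorem dominates_at_of_dens_eq_zero {d : X → X → ℝ} {r : ℝ} (hr : 0 ≤ r) {μ ν : IdempMeas X}
    {x : X} (hx : dens μ x = 0) (y : X) :
    dens μ x * Real.exp (d x y) ≤ dens ν y * Real.exp r ∧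
      dens μ x * (Real.exp (d x y) - 1) ≤ dens ν y * (Real.exp r - 1) := by
  rw [hx, zero_mul, zero_mul]
  exact ⟨mul_nonneg (dens_nonneg _ _) (Real.exp_pos _).le,
    mul_nonneg (dens_nonneg _ _) (exp_sub_one_nonneg hr)⟩

/-- At a point of full density of the target only the second condition matters. -/
theorem dominates_at_of_dens_eq_one {d : X → X → ℝ} {r : ℝ} {μ ν : IdempMeas X} {x y : X}
    (hy : dens ν y = 1) (h : dens μ x * (Real.exp (d x y) - 1) ≤ Real.exp r - 1) :
    dens μ x * Real.exp (d x y) ≤ dens ν y * Real.exp r ∧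
      dens μ x * (Real.exp (d x y) - 1) ≤ dens ν y * (Real.exp r - 1) := by
  rw [hy, one_mul, one_mul]
  exact ⟨by linarith [dens_le_one μ x], h⟩

/-- Here p, q, s are densities at x, y, z; a, b are exponentials of distances and ρ, σ of costs. If
s ≤ p, the second claim follows from the first. Otherwise ab − 1 is split as a(b − 1) + (a − 1) when
q ≤ s, and as (a − 1)b + (b − 1) when p ≤ s ≤ q, so that each leftover term may change its density
factor in the right direction. -/
theorem cost_trans {p q s a b ρ σ : ℝ} (hb : 1 ≤ b) (hρ : 1 ≤ ρ)
    (h1 : p * a ≤ q * ρ) (h2 : p * (a - 1) ≤ q * (ρ - 1))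
    (h3 : q * b ≤ s * σ) (h4 : q * (b - 1) ≤ s * (σ - 1)) :
    p * (a * b) ≤ s * (ρ * σ) ∧ p * (a * b - 1) ≤ s * (ρ * σ - 1) := by
  have hA : p * (a * b) ≤ s * (ρ * σ) := by
    calc p * (a * b) = p * a * b := by ring
      _ ≤ q * ρ * b := mul_le_mul_of_nonneg_right h1 (by linarith)
      _ = q * b * ρ := by ring
      _ ≤ s * σ * ρ := mul_le_mul_of_nonneg_right h3 (by linarith)
      _ = s * (ρ * σ) := by ring
  refine ⟨hA, ?_⟩
  rcases le_total s p with hsp | hsp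
  · linarith
  rcases le_total q s with hqs | hqs
  · calc p * (a * b - 1) = p * a * (b - 1) + p * (a - 1) := by ring
      _ ≤ q * ρ * (b - 1) + q * (ρ - 1) :=
        add_le_add (mul_le_mul_of_nonneg_right h1 (by linarith)) h2
      _ = q * (b - 1) * ρ + q * (ρ - 1) := by ring
      _ ≤ s * (σ - 1) * ρ + s * (ρ - 1) :=
        add_le_add (mul_le_mul_of_nonneg_right h4 (by linarith))
          (mul_le_mul_of_nonneg_right hqs (by linarith))
      _ = s * (ρ * σ - 1) := by ring
  · calc p * (a * b - 1) = p * (a - 1) * b + p * (b - 1) := by ring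
      _ ≤ q * (ρ - 1) * b + q * (b - 1) :=
        add_le_add (mul_le_mul_of_nonneg_right h2 (by linarith))
          (mul_le_mul_of_nonneg_right (hsp.trans hqs) (by linarith))
      _ = q * b * (ρ - 1) + q * (b - 1) := by ring
      _ ≤ s * σ * (ρ - 1) + s * (σ - 1) :=
        add_le_add (mul_le_mul_of_nonneg_right h3 (by linarith)) h4
      _ = s * (ρ * σ - 1) := by ring

theorem Dominates.trans {d : X → X → ℝ} (h0 : ∀ x y, 0 ≤ d x y)
    (ht : ∀ x y z, d x z ≤ d x y + d y z) {r s : ℝ} (hr : 0 ≤ r)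
    {μ ν κ : IdempMeas X} (h : Dominates d r μ ν) (h' : Dominates d s ν κ) :
    Dominates d (r + s) μ κ := fun x => by
  obtain ⟨y, h1, h2⟩ := h x
  obtain ⟨z, h3, h4⟩ := h' y
  obtain ⟨h5, h6⟩ := cost_trans (Real.one_le_exp (h0 y z)) (Real.one_le_exp hr) h1 h2 h3 h4
  rw [← Real.exp_add, ← Real.exp_add] at h5 h6
  have he := Real.exp_le_exp.2 (ht x y z)
  exact ⟨z, (mul_le_mul_of_nonneg_left he (dens_nonneg _ _)).trans h5,
    (mul_le_mul_of_nonneg_left (sub_le_sub_right he 1) (dens_nonneg _ _)).trans h6⟩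

theorem dominates_refl {d : X → X → ℝ} (hd : ∀ x, d x x = 0) (μ : IdempMeas X) :
    Dominates d 0 μ μ := fun x => ⟨x, by rw [hd], by rw [hd]⟩

theorem densDist_comm (d : X → X → ℝ) (μ ν : IdempMeas X) :
    densDist d μ ν = densDist d ν μ := by
  simp only [densDist, and_comm]

theorem densDist_nonneg (d : X → X → ℝ) (μ ν : IdempMeas X) : 0 ≤ densDist d μ ν :=
  Real.sInf_nonneg fun _ h => h.1

theorem densDist_le {d : X → X → ℝ} {r : ℝ} {μ ν : IdempMeas X} (hr : 0 ≤ r)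
    (h : Dominates d r μ ν) (h' : Dominates d r ν μ) : densDist d μ ν ≤ r :=
  csInf_le ⟨0, fun _ h => h.1⟩ ⟨hr, h, h'⟩

variable {d : X → X → ℝ} {B : ℝ} (h0 : ∀ x y, 0 ≤ d x y) (hB : ∀ x y, d x y ≤ B)
  (hs : ∀ x y, d x y = d y x)

include hB in
theorem dominates_bound (μ ν : IdempMeas X) (hB0 : 0 ≤ B) : Dominates d B μ ν := fun x => by
  obtain ⟨y, hy⟩ := exists_dens_eq_one ν
  refine ⟨y, dominates_at_of_dens_eq_one hy ?_⟩
  calc dens μ x * (Real.exp (d x y) - 1) ≤ dens μ x * (Real.exp B - 1) :=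
        mul_le_mul_of_nonneg_left (sub_le_sub_right (Real.exp_le_exp.2 (hB x y)) 1)
          (dens_nonneg _ _)
    _ ≤ 1 * (Real.exp B - 1) :=
        mul_le_mul_of_nonneg_right (dens_le_one _ _) (exp_sub_one_nonneg hB0)
    _ = _ := one_mul _

include h0 hB in
theorem bound_nonneg (μ : IdempMeas X) : 0 ≤ B :=
  let ⟨x, _⟩ := exists_dens_eq_one μ
  (h0 x x).trans (hB x x)

include h0 hB in
theorem densDist_le_bound (μ ν : IdempMeas X) : densDist d μ ν ≤ B :=
  densDist_le (bound_nonneg h0 hB μ) (dominates_bound hB μ ν (bound_nonneg h0 hB μ))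
    (dominates_bound hB ν μ (bound_nonneg h0 hB μ))

include h0 hB in
theorem dominates_of_densDist_lt {r : ℝ} {μ ν : IdempMeas X} (h : densDist d μ ν < r) :
    Dominates d r μ ν ∧ Dominates d r ν μ := by
  obtain ⟨s, ⟨-, h1, h2⟩, hsr⟩ := exists_lt_of_csInf_lt
    (s := {r | 0 ≤ r ∧ Dominates d r μ ν ∧ Dominates d r ν μ})
    ⟨B, bound_nonneg h0 hB μ, dominates_bound hB μ ν (bound_nonneg h0 hB μ),
      dominates_bound hB ν μ (bound_nonneg h0 hB μ)⟩ h
  exact ⟨h1.mono hsr.le, h2.mono hsr.le⟩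

include h0 hB in
theorem densDist_triangle (ht : ∀ x y z, d x z ≤ d x y + d y z) (μ ν κ : IdempMeas X) :
    densDist d μ κ ≤ densDist d μ ν + densDist d ν κ := by
  refine le_of_forall_pos_le_add fun ε hε => ?_
  obtain ⟨h1, h2⟩ := dominates_of_densDist_lt h0 hB
    (show densDist d μ ν < densDist d μ ν + ε / 2 by linarith)
  obtain ⟨h3, h4⟩ := dominates_of_densDist_lt h0 hB
    (show densDist d ν κ < densDist d ν κ + ε / 2 by linarith)
  have e1 := densDist_nonneg d μ ν
  have e2 := densDist_nonneg d ν κ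
  refine (densDist_le (by linarith) (h1.trans h0 ht (by linarith) h3) ?_).trans
    (show _ ≤ _ by linarith)
  rw [add_comm]
  exact h4.trans h0 ht (by linarith) h2

theorem densDist_self (hd : ∀ x, d x x = 0) (μ : IdempMeas X) : densDist d μ μ = 0 :=
  le_antisymm (densDist_le le_rfl (dominates_refl hd μ) (dominates_refl hd μ))
    (densDist_nonneg _ _ _)

include h0 in
-- As r → 0, the second inequality forces the partner y towards x and the first keeps `dens ν y`
-- above `dens μ x * exp (-r)`. A smaller density of ν at x would contradict upper semicontinuity.
theorem dens_le_of_forall_dominates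
    (hopen : ∀ U : Set X, IsOpen U → ∀ x ∈ U, ∃ ε > 0, ∀ y, d x y < ε → y ∈ U)
    {μ ν : IdempMeas X} (h : ∀ r > 0, Dominates d r μ ν) (x : X) : dens μ x ≤ dens ν x := by
  by_contra! hlt
  obtain ⟨c, hc1, hc2⟩ := exists_between hlt
  obtain ⟨ε, hε, hball⟩ := hopen _ (isOpen_dens_lt ν c) x hc1
  have hpos : 0 < dens μ x := (dens_nonneg ν x).trans_lt hlt
  have t1 : ∀ᶠ r in nhdsWithin (0 : ℝ) (Set.Ioi 0), c < dens μ x * Real.exp (-r) := by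
    refine Filter.Tendsto.eventually_const_lt (v := dens μ x) hc2 ?_
    have : Continuous fun r : ℝ => dens μ x * Real.exp (-r) := by fun_prop
    simpa using (this.tendsto 0).mono_left nhdsWithin_le_nhds
  have t2 : ∀ᶠ r in nhdsWithin (0 : ℝ) (Set.Ioi 0),
      Real.exp r - 1 < dens μ x * (Real.exp ε - 1) := by
    refine Filter.Tendsto.eventually_lt_const (v := 0)
      (mul_pos hpos (sub_pos.2 (Real.one_lt_exp_iff.2 hε))) ?_
    have : Continuous fun r : ℝ => Real.exp r - 1 := by fun_prop
    simpa using (this.tendsto 0).mono_left nhdsWithin_le_nhds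
  obtain ⟨r, ⟨hr1, hr2⟩, hr⟩ := ((t1.and t2).and self_mem_nhdsWithin).exists
  have hr : 0 < r := hr
  obtain ⟨y, h1, h2⟩ := h r hr x
  have hy : d x y < ε := by
    have h3 : dens μ x * (Real.exp (d x y) - 1) < dens μ x * (Real.exp ε - 1) := by
      refine (h2.trans ?_).trans_lt hr2
      exact mul_le_of_le_one_left (exp_sub_one_nonneg hr.le) (dens_le_one _ _)
    have h4 := lt_of_mul_lt_mul_left h3 hpos.le
    exact Real.exp_lt_exp.1 (by linarith)
  have h5 : dens ν y < c := hball y hy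
  have h6 : dens μ x ≤ dens ν y * Real.exp r := by
    refine le_trans ?_ h1
    exact le_mul_of_one_le_right hpos.le (Real.one_le_exp (h0 x y))
  have h7 : dens μ x * Real.exp (-r) ≤ dens ν y := by
    rw [Real.exp_neg, ← div_eq_mul_inv, div_le_iff₀ (Real.exp_pos _)]
    exact h6
  linarith

include h0 hB in
theorem eq_of_densDist_eq_zero
    (hopen : ∀ U : Set X, IsOpen U → ∀ x ∈ U, ∃ ε > 0, ∀ y, d x y < ε → y ∈ U)
    {μ ν : IdempMeas X} (h : densDist d μ ν = 0) : μ = ν :=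
  ext_dens fun x => le_antisymm
    (dens_le_of_forall_dominates h0 hopen
      (fun _ hr => (dominates_of_densDist_lt h0 hB (h.trans_lt hr)).1) x)
    (dens_le_of_forall_dominates h0 hopen
      (fun _ hr => (dominates_of_densDist_lt h0 hB (h.trans_lt hr)).2) x)

theorem apply_le_add {μ : IdempMeas X} {φ χ : C(X, ℝ)} {c : ℝ} (h : ∀ x, φ x ≤ χ x + c) :
    μ.1 φ ≤ μ.1 χ + c := by
  rw [← μ.2.2.1]
  exact μ.mono h

/-- Test functions `-L d(x, ·)`. -/
def coneFun (hd : Continuous fun p : X × X => d p.1 p.2) (L : ℝ) (x : X) : C(X, ℝ) :=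
  ⟨fun y => -(L * d x y), (continuous_const.mul (hd.comp (Continuous.prodMk_right x))).neg⟩

include h0 in
-- The partner of x is the point where ν attains its value on the cone function with apex x. In the
-- slope, the summand 1 absorbs e^D for the first inequality, and e^r / r yields the second through
-- t·e^{−t} ≤ 1 with t = e^r·D / r.
theorem dominates_of_apply_coneFun_le (hdiag : ∀ x, d x x = 0)
    (hd : Continuous fun p : X × X => d p.1 p.2) {r : ℝ} (hr : 0 < r) {μ ν : IdempMeas X}
    (h : ∀ x, μ.1 (coneFun hd (1 + Real.exp r / r) x)
      ≤ ν.1 (coneFun hd (1 + Real.exp r / r) x) + r) : Dominates d r μ ν := fun x => by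
  set φ := coneFun hd (1 + Real.exp r / r) x with hφ
  obtain ⟨y, hy⟩ := exists_dens_mul_exp_eq ν φ
  have h1 : dens μ x ≤ dens ν y * Real.exp (φ y) * Real.exp r := by
    rw [hy, ← Real.exp_add]
    refine le_trans ?_ (Real.exp_le_exp.2 (h x))
    have := dens_mul_exp_le μ φ x
    simpa [hφ, coneFun, hdiag] using this
  set D := d x y with hD
  have hD0 : 0 ≤ D := h0 x y
  have hφy : φ y = -D - Real.exp r / r * D := by
    simp only [hφ, coneFun, ContinuousMap.coe_mk]; ring
  have hL : 0 ≤ Real.exp r / r * D := mul_nonneg (div_pos (Real.exp_pos _) hr).le hD0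
  have hq := dens_nonneg ν y
  refine ⟨y, ?_, ?_⟩
  · calc dens μ x * Real.exp D ≤ dens ν y * Real.exp (φ y) * Real.exp r * Real.exp D :=
          mul_le_mul_of_nonneg_right h1 (Real.exp_pos _).le
      _ = dens ν y * Real.exp r * Real.exp (φ y + D) := by rw [Real.exp_add]; ring
      _ ≤ dens ν y * Real.exp r * 1 := by
          refine mul_le_mul_of_nonneg_left (Real.exp_le_one_iff.2 ?_)
            (mul_nonneg hq (Real.exp_pos _).le)
          rw [hφy]; linarith
      _ = _ := mul_one _
  · have hexp : Real.exp D - 1 ≤ D * Real.exp D := by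
      have h2 := Real.add_one_le_exp (-D)
      have h3 : Real.exp (-D) * Real.exp D = 1 := by rw [← Real.exp_add]; simp
      nlinarith [Real.exp_pos D]
    have hcone : Real.exp (φ y) * Real.exp r * (Real.exp D - 1) ≤ Real.exp r - 1 := by
      have e1 : Real.exp (φ y) * Real.exp D * (Real.exp r / r * D) ≤ 1 := by
        rw [← Real.exp_add, hφy]
        have h2 := Real.add_one_le_exp (Real.exp r / r * D)
        calc Real.exp (-D - Real.exp r / r * D + D) * (Real.exp r / r * D)
            ≤ Real.exp (-D - Real.exp r / r * D + D) * Real.exp (Real.exp r / r * D) :=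
              mul_le_mul_of_nonneg_left (by linarith) (Real.exp_pos _).le
          _ = 1 := by rw [← Real.exp_add]; ring_nf; exact Real.exp_zero
      calc Real.exp (φ y) * Real.exp r * (Real.exp D - 1)
          ≤ Real.exp (φ y) * Real.exp r * (D * Real.exp D) :=
            mul_le_mul_of_nonneg_left hexp
              (mul_nonneg (Real.exp_pos _).le (Real.exp_pos _).le)
        _ = Real.exp (φ y) * Real.exp D * (Real.exp r / r * D) * r := by
            field_simp
        _ ≤ 1 * r := mul_le_mul_of_nonneg_right e1 hr.le
        _ ≤ Real.exp r - 1 := by linarith [Real.add_one_le_exp r]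
    calc dens μ x * (Real.exp D - 1)
        ≤ dens ν y * Real.exp (φ y) * Real.exp r * (Real.exp D - 1) :=
          mul_le_mul_of_nonneg_right h1 (exp_sub_one_nonneg hD0)
      _ = dens ν y * (Real.exp (φ y) * Real.exp r * (Real.exp D - 1)) := by ring
      _ ≤ dens ν y * (Real.exp r - 1) := mul_le_mul_of_nonneg_left hcone hq

include h0 hs in
theorem densDist_lt_mem_nhds (hdiag : ∀ x, d x x = 0)
    (ht : ∀ x y z, d x z ≤ d x y + d y z) (hd : Continuous fun p : X × X => d p.1 p.2)
    (μ : IdempMeas X) {ε : ℝ} (hε : 0 < ε) : {ν | densDist d μ ν < ε} ∈ nhds μ := by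
  obtain ⟨r, hr, hrε⟩ := exists_between hε
  set L := 1 + Real.exp r / r with hL
  have hL0 : 0 < L := add_pos one_pos (div_pos (Real.exp_pos _) hr)
  have key : ∀ᶠ ν in nhds μ, ∀ x ∈ (Set.univ : Set X),
      μ.1 (coneFun hd L x) ≤ ν.1 (coneFun hd L x) + r ∧
        ν.1 (coneFun hd L x) ≤ μ.1 (coneFun hd L x) + r := by
    refine isCompact_univ.induction_on (p := fun S => ∀ᶠ ν in nhds μ, ∀ x ∈ S,
      μ.1 (coneFun hd L x) ≤ ν.1 (coneFun hd L x) + r ∧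
        ν.1 (coneFun hd L x) ≤ μ.1 (coneFun hd L x) + r) ?_ ?_ ?_ ?_
    · simp
    · intro s t hst h
      filter_upwards [h] with ν hν x hx using hν x (hst hx)
    · intro s t h h'
      filter_upwards [h, h'] with ν hν hν' x hx
      exact hx.elim (hν x) (hν' x)
    · intro x _
      have hc : Continuous fun y => L * d x y :=
        continuous_const.mul (hd.comp (Continuous.prodMk_right x))
      -- Cone functions with such apexes differ by at most r/3 uniformly, so finitely many apexes
      -- control all; the third r/3 is the pointwise closeness of μ and ν.
      refine ⟨{y | L * d x y < r / 3}, mem_nhdsWithin_of_mem_nhds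
        ((isOpen_lt hc continuous_const).mem_nhds ?_), ?_⟩
      · simp only [Set.mem_ofPred_eq, hdiag, mul_zero]; positivity
      · have hev : Filter.Tendsto (fun ν : IdempMeas X => ν.1 (coneFun hd L x)) (nhds μ)
            (nhds (μ.1 (coneFun hd L x))) := (eval (coneFun hd L x)).continuous.tendsto μ
        filter_upwards [hev.eventually_lt_const
            (show μ.1 (coneFun hd L x) < μ.1 (coneFun hd L x) + r / 3 by linarith),
          hev.eventually_const_lt
            (show μ.1 (coneFun hd L x) - r / 3 < μ.1 (coneFun hd L x) by linarith)]
          with ν hν1 hν2 y hy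
        have hy : L * d x y < r / 3 := hy
        have c1 : ∀ z, coneFun hd L x z ≤ coneFun hd L y z + r / 3 := fun z => by
          have := mul_le_mul_of_nonneg_left (ht y x z) hL0.le
          rw [hs y x] at this
          simp only [coneFun, ContinuousMap.coe_mk]
          linarith
        have c2 : ∀ z, coneFun hd L y z ≤ coneFun hd L x z + r / 3 := fun z => by
          have := mul_le_mul_of_nonneg_left (ht x y z) hL0.le
          simp only [coneFun, ContinuousMap.coe_mk]
          linarith
        have a1 := apply_le_add (μ := μ) c1
        have a2 := apply_le_add (μ := μ) c2
        have a3 := apply_le_add (μ := ν) c1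
        have a4 := apply_le_add (μ := ν) c2
        constructor <;> linarith
  filter_upwards [key] with ν hν
  exact (densDist_le hr.le
    (dominates_of_apply_coneFun_le h0 hdiag hd hr fun x => (hν x trivial).1)
    (dominates_of_apply_coneFun_le h0 hdiag hd hr fun x => (hν x trivial).2)).trans_lt hrε

include h0 hB hs in
-- Only y can be a partner, and at full target density the second inequality implies the first.
-- Radii s > r are used because attainment of the infimum is not established at this point.
theorem densDist_dirac_le_iff {μ : IdempMeas X} {y : X} {r : ℝ} (hr : 0 ≤ r) :
    densDist d μ (dirac y) ≤ r ↔ ∀ x, dens μ x * (Real.exp (d x y) - 1) ≤ Real.exp r - 1 := by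
  constructor
  · intro h x
    have hlim : Filter.Tendsto (fun s : ℝ => Real.exp s - 1) (nhdsWithin r (Set.Ioi r))
        (nhds (Real.exp r - 1)) :=
      ((Real.continuous_exp.sub continuous_const).tendsto r).mono_left nhdsWithin_le_nhds
    refine ge_of_tendsto hlim ?_
    filter_upwards [self_mem_nhdsWithin] with s hs'
    have hs' : r < s := hs'
    obtain ⟨z, h1, h2⟩ := (dominates_of_densDist_lt h0 hB (h.trans_lt hs')).1 x
    rcases (dens_nonneg μ x).eq_or_lt with hx | hx
    · rw [← hx, zero_mul]
      exact exp_sub_one_nonneg (hr.trans hs'.le)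
    · have hz : z = y := by
        by_contra hne
        rw [dens_dirac_of_ne hne, zero_mul] at h1
        exact absurd h1 (not_le.2 (mul_pos hx (Real.exp_pos _)))
      rwa [hz, dens_dirac_self, one_mul] at h2
  · intro h
    refine densDist_le hr (fun x => ⟨y, dominates_at_of_dens_eq_one (dens_dirac_self y) (h x)⟩)
      fun x => ?_
    by_cases hx : x = y
    · obtain ⟨z, hz⟩ := exists_dens_eq_one μ
      refine ⟨z, dominates_at_of_dens_eq_one hz ?_⟩
      rw [hx, dens_dirac_self, one_mul, hs]
      simpa [hz] using h z
    · exact ⟨x, dominates_at_of_dens_eq_zero hr (dens_dirac_of_ne hx) x⟩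

include h0 hB hs in
theorem densDist_dirac_dirac (x y : X) : densDist d (dirac x) (dirac y) = d x y := by
  have key : ∀ c, 0 ≤ c → (densDist d (dirac x) (dirac y) ≤ c ↔ d x y ≤ c) := by
    intro c hc
    rw [densDist_dirac_le_iff h0 hB hs hc]
    constructor
    · intro h
      have := h x
      rw [dens_dirac_self, one_mul] at this
      exact Real.exp_le_exp.1 (by linarith)
    · intro h z
      by_cases hz : z = x
      · rw [hz, dens_dirac_self, one_mul]
        linarith [Real.exp_le_exp.2 h]
      · rw [dens_dirac_of_ne hz, zero_mul]
        exact exp_sub_one_nonneg hc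
  exact le_antisymm ((key _ (h0 x y)).2 le_rfl) ((key _ (densDist_nonneg _ _ _)).1 le_rfl)

include h0 hB hs in
/-- If `μ` is far from all Dirac measures, then so is `I(δ)(μ)`. -/
theorem le_densDist_map_dirac {ε : ℝ} {μ : IdempMeas X}
    (h : ∀ x, ε ≤ densDist d μ (dirac x)) (ν : IdempMeas X) :
    ε ≤ densDist (densDist d) (map ⟨dirac, continuous_dirac⟩ μ) (dirac ν) := by
  -- Full density at y gives d(x, y) ≤ d₁(ν, δ_x) for every x.
  obtain ⟨y, hy⟩ := exists_dens_eq_one ν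
  refine (h y).trans ((densDist_dirac_le_iff h0 hB hs (densDist_nonneg _ _ _)).2 fun x => ?_)
  have h1 := (densDist_dirac_le_iff (densDist_nonneg d) (densDist_le_bound h0 hB)
    (densDist_comm d) (densDist_nonneg _ _ _)).1
    (le_refl (densDist (densDist d) (map ⟨dirac, continuous_dirac⟩ μ) (dirac ν))) (dirac x)
  have h2 := (densDist_dirac_le_iff h0 hB hs (densDist_nonneg _ _ _)).1
    (le_refl (densDist d ν (dirac x))) y
  rw [hy, one_mul, hs y x, densDist_comm] at h2
  refine le_trans (mul_le_mul ?_ h2 (exp_sub_one_nonneg (h0 x y)) (dens_nonneg _ _)) h1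
  exact dens_le_dens_map ⟨dirac, continuous_dirac⟩ μ x

include h0 hB hs in
-- By `densDist_dirac_le_iff`, each side is governed by the products dens N μ · dens μ z ·
-- (e^{d(z,x)} − 1); the max formula for the join makes the two families of bounds equivalent.
theorem densDist_join_dirac (N : IdempMeas (IdempMeas X)) (x : X) :
    densDist d (join N) (dirac x) = densDist (densDist d) N (dirac (dirac x)) := by
  have key : ∀ c, 0 ≤ c → (densDist d (join N) (dirac x) ≤ c ↔
      densDist (densDist d) N (dirac (dirac x)) ≤ c) := by
    intro c hc
    rw [densDist_dirac_le_iff h0 hB hs hc, densDist_dirac_le_iff (densDist_nonneg d)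
      (densDist_le_bound h0 hB) (densDist_comm d) hc]
    constructor
    · intro h μ
      rcases (dens_nonneg N μ).eq_or_lt with hμ | hμ
      · rw [← hμ, zero_mul]; exact exp_sub_one_nonneg hc
      · rw [mul_comm, ← le_div_iff₀ hμ]
        have hq : 0 ≤ (Real.exp c - 1) / dens N μ := div_nonneg (exp_sub_one_nonneg hc) hμ.le
        have hl : 0 < (Real.exp c - 1) / dens N μ + 1 := by linarith
        -- The radius solves dens N μ · (e^t − 1) = e^c − 1 for t.
        have h1 : densDist d μ (dirac x) ≤ Real.log ((Real.exp c - 1) / dens N μ + 1) := by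
          rw [densDist_dirac_le_iff h0 hB hs (Real.log_nonneg (by linarith)), Real.exp_log hl]
          intro z
          rw [add_sub_cancel_right, le_div_iff₀ hμ, mul_comm, ← mul_assoc]
          exact (mul_le_mul_of_nonneg_right (dens_mul_dens_le_dens_join N μ z)
            (exp_sub_one_nonneg (h0 z x))).trans (h z)
        have h2 := Real.exp_le_exp.2 h1
        rw [Real.exp_log hl] at h2
        linarith
    · intro h z
      obtain ⟨μ, hμ⟩ := exists_dens_join_eq N z
      rw [hμ, mul_assoc]
      refine le_trans (mul_le_mul_of_nonneg_left ?_ (dens_nonneg _ _)) (h μ)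
      exact (densDist_dirac_le_iff h0 hB hs (densDist_nonneg _ _ _)).1 le_rfl z
  exact le_antisymm ((key _ (densDist_nonneg _ _ _)).2 le_rfl)
    ((key _ (densDist_nonneg _ _ _)).1 le_rfl)

include h0 hB in
-- Partners are followed twice: from x to a μ realising the density of the join, to its partner ν,
-- then to the partner y of x for the pair (μ, ν). The gap r < s pays for replacing `densDist d μ ν`
-- by a slightly larger cost.
theorem Dominates.join {M N : IdempMeas (IdempMeas X)} {r s : ℝ} (hr : 0 ≤ r) (hrs : r < s)
    (h : Dominates (densDist d) r M N) : Dominates d s (join M) (join N) := fun x => by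
  obtain ⟨μ, hμ⟩ := exists_dens_join_eq M x
  rcases (dens_nonneg M μ).eq_or_lt with hM | hM
  · exact ⟨x, dominates_at_of_dens_eq_zero (hr.trans hrs.le) (by rw [hμ, ← hM, zero_mul]) x⟩
  obtain ⟨ν, h1, h2⟩ := h μ
  have hN : 0 < dens N ν :=
    pos_of_mul_pos_left ((mul_pos hM (Real.exp_pos _)).trans_le h1) (Real.exp_pos _).le
  have t : ∀ᶠ c in nhdsWithin (densDist d μ ν) (Set.Ioi (densDist d μ ν)),
      dens M μ * Real.exp c < dens N ν * Real.exp s ∧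
        dens M μ * (Real.exp c - 1) < dens N ν * (Real.exp s - 1) := by
    have c1 : Continuous fun c : ℝ => dens M μ * Real.exp c := by fun_prop
    have c2 : Continuous fun c : ℝ => dens M μ * (Real.exp c - 1) := by fun_prop
    have hlt := Real.exp_lt_exp.2 hrs
    refine Filter.Eventually.and ?_ ?_
    · exact ((c1.tendsto _).mono_left nhdsWithin_le_nhds).eventually_lt_const
        (h1.trans_lt (mul_lt_mul_of_pos_left hlt hN))
    · exact ((c2.tendsto _).mono_left nhdsWithin_le_nhds).eventually_lt_const
        (h2.trans_lt (mul_lt_mul_of_pos_left (sub_lt_sub_right hlt 1) hN))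
  obtain ⟨c, ⟨hc1, hc2⟩, hc⟩ := (t.and self_mem_nhdsWithin).exists
  obtain ⟨y, h3, h4⟩ := (dominates_of_densDist_lt h0 hB hc).1 x
  have hs0 := exp_sub_one_nonneg (hr.trans hrs.le)
  have hy := dens_mul_dens_le_dens_join N ν y
  refine ⟨y, ?_, ?_⟩
  · calc dens (IdempMeas.join M) x * Real.exp (d x y)
        = dens M μ * (dens μ x * Real.exp (d x y)) := by rw [hμ, mul_assoc]
      _ ≤ dens M μ * (dens ν y * Real.exp c) := mul_le_mul_of_nonneg_left h3 hM.le
      _ = dens M μ * Real.exp c * dens ν y := by ring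
      _ ≤ dens N ν * Real.exp s * dens ν y :=
          mul_le_mul_of_nonneg_right hc1.le (dens_nonneg _ _)
      _ = dens N ν * dens ν y * Real.exp s := by ring
      _ ≤ _ := mul_le_mul_of_nonneg_right hy (Real.exp_pos _).le
  · calc dens (IdempMeas.join M) x * (Real.exp (d x y) - 1)
        = dens M μ * (dens μ x * (Real.exp (d x y) - 1)) := by rw [hμ, mul_assoc]
      _ ≤ dens M μ * (dens ν y * (Real.exp c - 1)) := mul_le_mul_of_nonneg_left h4 hM.le
      _ = dens M μ * (Real.exp c - 1) * dens ν y := by ring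
      _ ≤ dens N ν * (Real.exp s - 1) * dens ν y :=
          mul_le_mul_of_nonneg_right hc2.le (dens_nonneg _ _)
      _ = dens N ν * dens ν y * (Real.exp s - 1) := by ring
      _ ≤ _ := mul_le_mul_of_nonneg_right hy hs0

include h0 hB in
theorem densDist_join_le (M N : IdempMeas (IdempMeas X)) :
    densDist d (join M) (join N) ≤ densDist (densDist d) M N := by
  refine le_of_forall_gt_imp_ge_of_dense fun s hs => ?_
  obtain ⟨r, hr, hrs⟩ := exists_between hs
  have hr0 : 0 ≤ r := (densDist_nonneg _ _ _).trans hr.le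
  obtain ⟨h1, h2⟩ := dominates_of_densDist_lt (densDist_nonneg d) (densDist_le_bound h0 hB) hr
  exact densDist_le (hr0.trans hrs.le) (h1.join h0 hB hr0 hrs) (h2.join h0 hB hr0 hrs)

theorem dominates_map_iff_of_isometry {d' : Y → Y → ℝ} (f : C(X, Y))
    (hf : Function.Injective f) (h : ∀ x y, d' (f x) (f y) = d x y) {r : ℝ} (hr : 0 ≤ r)
    (μ ν : IdempMeas X) : Dominates d' r (map f μ) (map f ν) ↔ Dominates d r μ ν := by
  constructor
  · intro H x
    rcases (dens_nonneg μ x).eq_or_lt with hx | hx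
    · exact ⟨x, dominates_at_of_dens_eq_zero hr hx.symm x⟩
    obtain ⟨y', h1, h2⟩ := H (f x)
    rw [dens_map_of_injective hf] at h1 h2
    have hy' : 0 < dens (map f ν) y' :=
      pos_of_mul_pos_left ((mul_pos hx (Real.exp_pos _)).trans_le h1) (Real.exp_pos _).le
    obtain ⟨y, rfl, hy⟩ := exists_dens_map_eq f ν hy'
    rw [← hy, h] at h1 h2
    exact ⟨y, h1, h2⟩
  · intro H x'
    rcases (dens_nonneg (map f μ) x').eq_or_lt with hx | hx
    · exact ⟨x', dominates_at_of_dens_eq_zero hr hx.symm x'⟩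
    obtain ⟨x, rfl, hx'⟩ := exists_dens_map_eq f μ hx
    obtain ⟨y, h1, h2⟩ := H x
    refine ⟨f y, ?_⟩
    rw [dens_map_of_injective hf, dens_map_of_injective hf, h]
    exact ⟨h1, h2⟩

theorem densDist_map_of_isometry {d' : Y → Y → ℝ} (f : C(X, Y))
    (hf : Function.Injective f) (h : ∀ x y, d' (f x) (f y) = d x y) (μ ν : IdempMeas X) :
    densDist d' (map f μ) (map f ν) = densDist d μ ν := by
  unfold densDist
  congr 1
  ext r
  exact and_congr_right fun hr => and_congr (dominates_map_iff_of_isometry f hf h hr μ ν)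
    (dominates_map_iff_of_isometry f hf h hr ν μ)

/-- With E = e^d, the bound a(1 + K(E − 1)) and the same bound minus 1 are nonnegative combinations
of E and E − 1, because a, K ≥ 1. The two domination inequalities therefore transfer to the image,
with s obtained from r by the same affine function. -/
theorem Dominates.map {d' : Y → Y → ℝ} (f : C(X, Y)) {a K : ℝ} (ha : 1 ≤ a) (hK : 1 ≤ K)
    (h : ∀ x y, Real.exp (d' (f x) (f y)) ≤ a * (1 + K * (Real.exp (d x y) - 1)))
    {r s : ℝ} (hr : 0 ≤ r) (hs : Real.exp s = a * (1 + K * (Real.exp r - 1)))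
    {μ ν : IdempMeas X} (H : Dominates d r μ ν) : Dominates d' s (map f μ) (map f ν) := by
  intro x'
  have hs0 : 0 ≤ s := by
    rw [← Real.one_le_exp_iff, hs]
    have := mul_nonneg (zero_le_one.trans hK) (exp_sub_one_nonneg hr)
    nlinarith
  rcases (dens_nonneg (IdempMeas.map f μ) x').eq_or_lt with hx | hx
  · exact ⟨x', dominates_at_of_dens_eq_zero hs0 hx.symm x'⟩
  obtain ⟨x, rfl, hx'⟩ := exists_dens_map_eq f μ hx
  obtain ⟨y, h1, h2⟩ := H x
  have h3 := h x y
  have hy := dens_le_dens_map f ν y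
  have hp := dens_nonneg μ x
  rw [← hx']
  set p := dens μ x
  set q := dens ν y
  set E := Real.exp (d x y)
  set R := Real.exp r
  have k1 : p * (1 + K * (E - 1)) ≤ q * (1 + K * (R - 1)) := by
    calc p * (1 + K * (E - 1)) = p * E + (K - 1) * (p * (E - 1)) := by ring
      _ ≤ q * R + (K - 1) * (q * (R - 1)) :=
        add_le_add h1 (mul_le_mul_of_nonneg_left h2 (by linarith))
      _ = _ := by ring
  have k2 : p * (a * (1 + K * (E - 1)) - 1) ≤ q * (a * (1 + K * (R - 1)) - 1) := by
    calc p * (a * (1 + K * (E - 1)) - 1)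
        = (a - 1) * (p * (1 + K * (E - 1))) + K * (p * (E - 1)) := by ring
      _ ≤ (a - 1) * (q * (1 + K * (R - 1))) + K * (q * (R - 1)) :=
        add_le_add (mul_le_mul_of_nonneg_left k1 (by linarith))
          (mul_le_mul_of_nonneg_left h2 (by linarith))
      _ = _ := by ring
  refine ⟨f y, ?_, ?_⟩
  · calc p * Real.exp (d' (f x) (f y)) ≤ p * (a * (1 + K * (E - 1))) :=
          mul_le_mul_of_nonneg_left h3 hp
      _ = a * (p * (1 + K * (E - 1))) := by ring
      _ ≤ a * (q * (1 + K * (R - 1))) := mul_le_mul_of_nonneg_left k1 (by linarith)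
      _ = q * Real.exp s := by rw [hs]; ring
      _ ≤ _ := mul_le_mul_of_nonneg_right hy (Real.exp_pos _).le
  · calc p * (Real.exp (d' (f x) (f y)) - 1) ≤ p * (a * (1 + K * (E - 1)) - 1) :=
          mul_le_mul_of_nonneg_left (by linarith) hp
      _ ≤ q * (a * (1 + K * (R - 1)) - 1) := k2
      _ = q * (Real.exp s - 1) := by rw [hs]
      _ ≤ _ := mul_le_mul_of_nonneg_right hy (exp_sub_one_nonneg hs0)

include h0 hB in
/-- Bounds for the modulus of continuity of `f` pass to `I(f)` unchanged. -/
theorem exp_densDist_map_le {d' : Y → Y → ℝ} (f : C(X, Y)) {a K : ℝ} (ha : 1 ≤ a) (hK : 1 ≤ K)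
    (h : ∀ x y, Real.exp (d' (f x) (f y)) ≤ a * (1 + K * (Real.exp (d x y) - 1)))
    (μ ν : IdempMeas X) : Real.exp (densDist d' (map f μ) (map f ν)) ≤
      a * (1 + K * (Real.exp (densDist d μ ν) - 1)) := by
  have hc : Continuous fun r : ℝ => a * (1 + K * (Real.exp r - 1)) := by fun_prop
  refine ge_of_tendsto ((hc.tendsto _).mono_left
    (nhdsWithin_le_nhds (s := Set.Ioi (densDist d μ ν)))) ?_
  filter_upwards [self_mem_nhdsWithin] with r hr
  have hr : densDist d μ ν < r := hr
  have hr0 : 0 ≤ r := (densDist_nonneg _ _ _).trans hr.le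
  obtain ⟨h1, h2⟩ := dominates_of_densDist_lt h0 hB hr
  have hge : 1 ≤ a * (1 + K * (Real.exp r - 1)) := by
    have := mul_nonneg (zero_le_one.trans hK) (exp_sub_one_nonneg hr0)
    nlinarith
  have he := Real.exp_log (zero_lt_one.trans_le hge)
  rw [← he, Real.exp_le_exp]
  exact densDist_le (Real.log_nonneg hge) (h1.map f ha hK h hr0 he) (h2.map f ha hK h hr0 he)

end Dominates

end IdempMeas

/-! ### Compatible metrics on compacta. -/

section CompatibleMetric

variable {X : CompHaus.{u}} {d : X → X → ℝ}

theorem IsCompatibleMetric.self_eq (hd : IsCompatibleMetric X d) (x : X) : d x x = 0 :=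
  (hd.eq_zero_iff x x).2 rfl

theorem IsCompatibleMetric.nonneg (hd : IsCompatibleMetric X d) (x y : X) : 0 ≤ d x y := by
  have := hd.triangle x y x
  rw [hd.self_eq, hd.symm y x] at this
  linarith

theorem IsCompatibleMetric.mem_nhds (hd : IsCompatibleMetric X d) (x : X) {ε : ℝ} (hε : 0 < ε) :
    {y | d x y < ε} ∈ nhds x := by
  refine IsOpen.mem_nhds ((hd.isOpen_iff _).2 fun y hy => ?_) ?_
  · have hy : d x y < ε := hy
    refine ⟨ε - d x y, by linarith, fun z hz => ?_⟩
    have := hd.triangle x y z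
    change d x z < ε
    linarith
  · change d x x < ε
    rwa [hd.self_eq]

theorem IsCompatibleMetric.continuous (hd : IsCompatibleMetric X d) :
    Continuous fun p : X × X => d p.1 p.2 := by
  rw [continuous_iff_continuousAt]
  rintro ⟨x, y⟩
  rw [ContinuousAt, Metric.tendsto_nhds]
  intro ε hε
  filter_upwards [prod_mem_nhds (hd.mem_nhds x (half_pos hε)) (hd.mem_nhds y (half_pos hε))]
  rintro ⟨x', y'⟩ ⟨h1, h2⟩
  have h1 : d x x' < ε / 2 := h1
  have h2 : d y y' < ε / 2 := h2
  have t1 := hd.triangle x x' y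
  have t2 := hd.triangle x' y' y
  have t3 := hd.triangle x' x y'
  have t4 := hd.triangle x y y'
  rw [hd.symm y' y] at t2
  rw [hd.symm x' x] at t3
  rw [Real.dist_eq, abs_lt]
  constructor <;> dsimp only <;> linarith

theorem IsCompatibleMetric.exists_bound (hd : IsCompatibleMetric X d) :
    ∃ B, ∀ x y, d x y ≤ B := by
  obtain ⟨B, hB⟩ := (isCompact_range hd.continuous).bddAbove
  exact ⟨B, fun x y => hB ⟨(x, y), rfl⟩⟩

/-- It suffices that balls are neighbourhoods: the complement of an open U is compact, so it stays
at positive distance from each point of U. -/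
theorem IsCompatibleMetric.of_mem_nhds (h1 : ∀ x y, d x y = 0 ↔ x = y)
    (h2 : ∀ x y, d x y = d y x) (h3 : ∀ x y z, d x z ≤ d x y + d y z)
    (h4 : ∀ x, ∀ ε > 0, {y | d x y < ε} ∈ nhds x) : IsCompatibleMetric X d where
  eq_zero_iff := h1
  symm := h2
  triangle := h3
  isOpen_iff U := by
    have hnn : ∀ x y, 0 ≤ d x y := fun x y => by
      have := h3 x y x
      rw [(h1 x x).2 rfl, h2 y x] at this
      linarith
    constructor
    · intro hU x hx
      have key : ∃ ε > 0, ∀ y ∈ Uᶜ, ε ≤ d x y := by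
        refine hU.isClosed_compl.isCompact.induction_on
          (p := fun S => ∃ ε > 0, ∀ y ∈ S, ε ≤ d x y) ⟨1, one_pos, by simp⟩ ?_ ?_ ?_
        · rintro s t hst ⟨ε, hε, h⟩
          exact ⟨ε, hε, fun y hy => h y (hst hy)⟩
        · rintro s t ⟨ε, hε, h⟩ ⟨ε', hε', h'⟩
          refine ⟨min ε ε', lt_min hε hε', ?_⟩
          rintro y (hy | hy)
          · exact (min_le_left _ _).trans (h y hy)
          · exact (min_le_right _ _).trans (h' y hy)
        · intro z hz
          have hpos : 0 < d x z := (hnn x z).lt_of_ne fun h => hz ((h1 x z).1 h.symm ▸ hx)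
          refine ⟨{y | d z y < d x z / 2}, mem_nhdsWithin_of_mem_nhds
            (h4 z _ (half_pos hpos)), d x z / 2, half_pos hpos, fun y hy => ?_⟩
          have hy : d z y < d x z / 2 := hy
          have := h3 x y z
          rw [h2 y z] at this
          linarith
      obtain ⟨ε, hε, h⟩ := key
      refine ⟨ε, hε, fun y hy => ?_⟩
      by_contra hyU
      exact absurd (h y hyU) (not_le.2 hy)
    · intro h
      rw [isOpen_iff_mem_nhds]
      intro x hx
      obtain ⟨ε, hε, hb⟩ := h x hx
      exact Filter.mem_of_superset (h4 x ε hε) hb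

theorem IsCompatibleMetric.uniformContinuous {Y : CompHaus.{u}} {d' : Y → Y → ℝ}
    (hd : IsCompatibleMetric X d) (hd' : IsCompatibleMetric Y d') {f : X → Y}
    (hf : Continuous f) {ε : ℝ} (hε : 0 < ε) :
    ∃ δ > 0, ∀ x y, d x y < δ → d' (f x) (f y) < ε := by
  have hK : IsCompact {p : X × X | ε ≤ d' (f p.1) (f p.2)} := IsClosed.isCompact <|
    isClosed_le continuous_const (hd'.continuous.comp (hf.prodMap hf))
  rcases Set.eq_empty_or_nonempty {p : X × X | ε ≤ d' (f p.1) (f p.2)} with he | hne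
  · refine ⟨1, one_pos, fun x y _ => ?_⟩
    by_contra! h
    exact Set.notMem_empty (x, y) (he ▸ h)
  · obtain ⟨p, hp, hmin⟩ := hK.exists_isMinOn hne hd.continuous.continuousOn
    refine ⟨d p.1 p.2, (hd.nonneg _ _).lt_of_ne fun h => ?_, fun x y hxy => ?_⟩
    · have hp : ε ≤ d' (f p.1) (f p.2) := hp
      rw [(hd.eq_zero_iff _ _).1 h.symm, hd'.self_eq] at hp
      linarith
    · by_contra! h
      exact absurd (hmin (a := (x, y)) h) (not_le.2 hxy)

theorem diameter_eq_of_isometry {Y : Type u} {d' : Y → Y → ℝ} {η : X → Y}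
    (hd : IsCompatibleMetric X d) (hη : ∀ x y, d' (η x) (η y) = d x y)
    (hY : Nonempty Y → Nonempty X)
    (hle : ∀ B, (∀ x y, d x y ≤ B) → ∀ a b, d' a b ≤ B) : diameter Y d' = diameter X d := by
  obtain ⟨B, hB⟩ := hd.exists_bound
  have hX : ∀ x y, d x y ≤ diameter X d := fun x y =>
    le_csSup ⟨B, by rintro _ ⟨p, rfl⟩; exact hB _ _⟩ ⟨(x, y), rfl⟩
  rcases isEmpty_or_nonempty Y with h | h
  · have : IsEmpty X := ⟨fun x => h.elim (η x)⟩
    rw [diameter, diameter, Set.range_eq_empty, Set.range_eq_empty]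
  · have := hY h
    apply le_antisymm
    · refine csSup_le (Set.range_nonempty _) ?_
      rintro _ ⟨p, rfl⟩
      exact hle _ hX _ _
    · refine csSup_le (Set.range_nonempty _) ?_
      rintro _ ⟨p, rfl⟩
      refine le_csSup ⟨B, by rintro _ ⟨p, rfl⟩; exact hle B hB _ _⟩ ⟨(η p.1, η p.2), ?_⟩
      exact hη _ _

end CompatibleMetric

/-! ### The distance on the direct limit, and iteration of P7. -/

section PlusDist

variable {F : CompHaus.{u} ⥤ CompHaus.{u}} (η : 𝟭 CompHaus.{u} ⟶ F) (D : DistRule F)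
  (X : CompHaus.{u}) (d : X → X → ℝ)

/-- The step `a ↦ η_{n,n+1}(a)` on the disjoint union of the iterates. -/
def stepUp (p : Σ n : ℕ, (iter F n).obj X) : Σ n : ℕ, (iter F n).obj X :=
  ⟨p.1 + 1, unitStep η X p.1 p.2⟩

/-- The distance of points of the same level. -/
def levelDist (p q : Σ n : ℕ, (iter F n).obj X) : ℝ :=
  -- The value 0 at different levels is a default that plays no role: `liftDist` first raises both
  -- points to level p.1 + q.1.
  if h : p.1 = q.1 then iterDist D X d q.1 (h ▸ p.2) q.2 else 0

theorem levelDist_mk (n : ℕ) (a b : (iter F n).obj X) :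
    levelDist D X d ⟨n, a⟩ ⟨n, b⟩ = iterDist D X d n a b := by
  rw [levelDist, dif_pos rfl]

/-- The distance of points after lifting both to a common level. -/
def liftDist (p q : Σ n : ℕ, (iter F n).obj X) : ℝ :=
  levelDist D X d ((stepUp η X)^[q.1] p) ((stepUp η X)^[p.1] q)

theorem stepUp_iterate_fst (k : ℕ) (p : Σ n : ℕ, (iter F n).obj X) :
    ((stepUp η X)^[k] p).1 = p.1 + k := by
  induction k with
  | zero => rfl
  | succ k ih => rw [Function.iterate_succ_apply', stepUp]; simp only [ih]; omega

theorem toPlus_stepUp_iterate (k : ℕ) (p : Σ n : ℕ, (iter F n).obj X) :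
    (Quot.mk _ ((stepUp η X)^[k] p) : Plus η X) = Quot.mk _ p := by
  induction k with
  | zero => rfl
  | succ k ih =>
    rw [Function.iterate_succ_apply', ← ih]
    exact (Quot.sound (PlusRel.step _ _)).symm

theorem exists_common_level (p q : Plus η X) :
    ∃ (n : ℕ) (a b : (iter F n).obj X), toPlus η X n a = p ∧ toPlus η X n b = q := by
  obtain ⟨p, rfl⟩ := Quot.exists_rep p
  obtain ⟨q, rfl⟩ := Quot.exists_rep q
  have h1 := stepUp_iterate_fst η X q.1 p
  have h2 := stepUp_iterate_fst η X p.1 q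
  rw [add_comm, ← h1] at h2
  rw [← toPlus_stepUp_iterate η X q.1 p, ← toPlus_stepUp_iterate η X p.1 q]
  generalize (stepUp η X)^[q.1] p = p' at h2 ⊢
  generalize (stepUp η X)^[p.1] q = q' at h2 ⊢
  obtain ⟨n, a⟩ := p'
  obtain ⟨m, b⟩ := q'
  obtain rfl : m = n := h2
  exact ⟨m, a, b, rfl, rfl⟩

variable (hiso : ∀ (n : ℕ) (a b : (iter F n).obj X),
  iterDist D X d (n + 1) (unitStep η X n a) (unitStep η X n b) = iterDist D X d n a b)

include hiso in
theorem levelDist_stepUp {p q : Σ n : ℕ, (iter F n).obj X} (h : p.1 = q.1) :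
    levelDist D X d (stepUp η X p) (stepUp η X q) = levelDist D X d p q := by
  obtain ⟨n, a⟩ := p
  obtain ⟨m, b⟩ := q
  obtain rfl : n = m := h
  exact (levelDist_mk D X d _ _ _).trans
    ((hiso n a b).trans (levelDist_mk D X d _ _ _).symm)

include hiso in
theorem liftDist_stepUp_left (p q : Σ n : ℕ, (iter F n).obj X) :
    liftDist η D X d (stepUp η X p) q = liftDist η D X d p q := by
  have e : (stepUp η X p).1 = p.1 + 1 := rfl
  rw [liftDist, e, ← Function.iterate_succ_apply, Function.iterate_succ_apply',
    Function.iterate_succ_apply', levelDist_stepUp η D X d hiso, liftDist]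
  rw [stepUp_iterate_fst, stepUp_iterate_fst, add_comm]

include hiso in
theorem liftDist_stepUp_right (p q : Σ n : ℕ, (iter F n).obj X) :
    liftDist η D X d p (stepUp η X q) = liftDist η D X d p q := by
  have e : (stepUp η X q).1 = q.1 + 1 := rfl
  rw [liftDist, e, ← Function.iterate_succ_apply, Function.iterate_succ_apply',
    Function.iterate_succ_apply', levelDist_stepUp η D X d hiso, liftDist]
  rw [stepUp_iterate_fst, stepUp_iterate_fst, add_comm]

include hiso in
theorem liftDist_same_level (n : ℕ) (a b : (iter F n).obj X) :
    liftDist η D X d ⟨n, a⟩ ⟨n, b⟩ = iterDist D X d n a b := by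
  have key : ∀ k, levelDist D X d ((stepUp η X)^[k] ⟨n, a⟩) ((stepUp η X)^[k] ⟨n, b⟩)
      = iterDist D X d n a b := by
    intro k
    induction k with
    | zero => simp [levelDist]
    | succ k ih =>
      rw [Function.iterate_succ_apply', Function.iterate_succ_apply',
        levelDist_stepUp η D X d hiso (by rw [stepUp_iterate_fst, stepUp_iterate_fst]), ih]
  exact key n

include hiso in
-- Since unit steps are isometric, `liftDist` descends to the quotient; hence the set whose infimum
-- defines `plusDist` is a singleton.
theorem plusDist_toPlus (n : ℕ) (a b : (iter F n).obj X) :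
    plusDist η D X d (toPlus η X n a) (toPlus η X n b) = iterDist D X d n a b := by
  let e : Plus η X → Plus η X → ℝ := Quot.lift₂ (liftDist η D X d)
    (by rintro p _ _ ⟨m, c⟩; exact (liftDist_stepUp_right η D X d hiso p ⟨m, c⟩).symm)
    (by rintro _ _ q ⟨m, c⟩; exact (liftDist_stepUp_left η D X d hiso ⟨m, c⟩ q).symm)
  have he : ∀ m a b, e (toPlus η X m a) (toPlus η X m b) = iterDist D X d m a b :=
    fun m a b => liftDist_same_level η D X d hiso m a b
  have hset : {r : ℝ | ∃ (m : ℕ) (a' b' : (iter F m).obj X),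
      toPlus η X m a' = toPlus η X n a ∧ toPlus η X m b' = toPlus η X n b ∧
        iterDist D X d m a' b' = r} = {iterDist D X d n a b} := by
    ext r
    constructor
    · rintro ⟨m, a', b', h1, h2, rfl⟩
      rw [Set.mem_singleton_iff, ← he, ← he, h1, h2]
    · rintro rfl
      exact ⟨n, a, b, rfl, rfl, rfl⟩
  rw [plusDist, hset, csInf_singleton]

/-- Uniform continuity of `F⁺(f)` follows from that of all `Fⁿ(f)` with a common modulus. -/
theorem plusMap_uniformContinuous {X Y : CompHaus.{u}} {d : X → X → ℝ} {d' : Y → Y → ℝ}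
    (hiso : ∀ (n : ℕ) (a b : (iter F n).obj X),
      iterDist D X d (n + 1) (unitStep η X n a) (unitStep η X n b) = iterDist D X d n a b)
    (hiso' : ∀ (n : ℕ) (a b : (iter F n).obj Y),
      iterDist D Y d' (n + 1) (unitStep η Y n a) (unitStep η Y n b) = iterDist D Y d' n a b)
    (f : X ⟶ Y) {δ ε : ℝ}
    (h : ∀ (n : ℕ) (a b : (iter F n).obj X), iterDist D X d n a b < δ →
      iterDist D Y d' n ((iter F n).map f a) ((iter F n).map f b) < ε)
    (p q : Plus η X) (hpq : plusDist η D X d p q < δ) :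
    plusDist η D Y d' (plusMap η f p) (plusMap η f q) < ε := by
  obtain ⟨n, a, b, rfl, rfl⟩ := exists_common_level η X p q
  rw [plusDist_toPlus η D X d hiso] at hpq
  change plusDist η D Y d' (toPlus η Y n _) (toPlus η Y n _) < ε
  rw [plusDist_toPlus η D Y d' hiso']
  exact h n a b hpq

/-- The iterated form of P7 follows from the basic form on all iterates. -/
theorem le_iterDist_qMap {ε : ℝ} {a : F.obj X}
    (h : ∀ x : X, ε ≤ D X d a (η.app X x))
    (hfar : ∀ (n : ℕ) (a : F.obj ((iter F n).obj X)),
      (∀ x, ε ≤ D _ (iterDist D X d n) a (η.app _ x)) →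
        ∀ b, ε ≤ D _ (iterDist D X d (n + 1)) (F.map (η.app ((iter F n).obj X)) a) (η.app _ b))
    (n : ℕ) : ε ≤ iterDist D X d (n + 2) (qMap η X (n + 1) a)
      (unitStep η X (n + 1) (qMap η X n a)) := by
  have hq : ∀ n, qMap η X (n + 1) a = F.map (η.app ((iter F n).obj X)) (qMap η X n a) := by
    intro n
    change F.map (unitIter η X n ≫ unitStep η X n) a = _
    rw [F.map_comp]
    rfl
  have key : ∀ n, ∀ x, ε ≤ D _ (iterDist D X d n) (qMap η X n a) (η.app _ x) := by
    intro n
    induction n with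
    | zero =>
      have : qMap η X 0 a = a := by
        change F.map (𝟙 X) a = a
        rw [F.map_id]; rfl
      rw [this]
      exact h
    | succ n ih => rw [hq]; exact hfar n _ ih
  rw [hq]
  exact hfar n _ (key n) _

end PlusDist

/-- The continuous map underlying a morphism. -/
abbrev homMap {X Y : CompHaus.{u}} (f : X ⟶ Y) : C(X, Y) := ConcreteCategory.hom f

/-! ### Preservation of inverse limits. -/

section Limits

variable {A : Type u} [PartialOrder A] [IsDirectedOrder A]

/-- A compatible family of nonempty closed subsets of an inverse system contains a thread. -/
theorem exists_thread_mem (K : Aᵒᵖ ⥤ CompHaus.{u}) (S : ∀ j, Set (K.obj j))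
    (hS : ∀ j, IsClosed (S j)) (hne : ∀ j, (S j).Nonempty)
    (hmap : ∀ {i j : Aᵒᵖ} (f : i ⟶ j), Set.MapsTo (K.map f) (S i) (S j)) :
    ∃ s : ∀ j, K.obj j, (∀ j, s j ∈ S j) ∧ ∀ {i j : Aᵒᵖ} (f : i ⟶ j), K.map f (s i) = s j := by
  let G : Aᵒᵖ ⥤ TopCat.{u} :=
    { obj := fun j => TopCat.of (S j)
      map := fun {i j} f => TopCat.ofHom
        ⟨(hmap f).restrict, (K.map f).hom.hom.continuous.restrict (hmap f)⟩
      map_id := fun j => by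
        ext x
        change (K.map (𝟙 j)) x.1 = x.1
        rw [K.map_id]; rfl
      map_comp := fun {i j k} f g => by
        ext x
        change (K.map (f ≫ g)) x.1 = K.map g (K.map f x.1)
        rw [K.map_comp]; rfl }
  have h1 : ∀ j, Nonempty (G.obj j) := fun j => (hne j).to_subtype
  have h2 : ∀ j, CompactSpace (G.obj j) := fun j =>
    isCompact_iff_compactSpace.1 (hS j).isCompact
  have h3 : ∀ j, T2Space (G.obj j) := fun j => inferInstanceAs (T2Space (S j))
  obtain ⟨⟨s, hs⟩⟩ := TopCat.nonempty_limitCone_of_compact_t2_cofiltered_system.{u, u} G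
  exact ⟨fun j => (s j).1, fun j => (s j).2, fun f => congrArg Subtype.val (hs f)⟩

variable {K : Aᵒᵖ ⥤ CompHaus.{u}} (c : Cone K)

theorem map_π_app {i j : Aᵒᵖ}
    (g : i ⟶ j) (x : c.pt) : K.map g (c.π.app i x) = c.π.app j x := by
  rw [← c.w g]; rfl

namespace IdempMeas

/-- Over each π_j(x) lies a point where ν has density at least `dens μ x`. These points form
directed nonempty compact sets, whose intersection can contain only x. -/
theorem dens_le_of_map_π_eq [Nonempty A]
    (hinj : ∀ x y : c.pt, (∀ j, c.π.app j x = c.π.app j y) → x = y)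
    {μ ν : IdempMeas c.pt}
    (h : ∀ j, map (homMap (X := c.pt) (c.π.app j)) μ = map (homMap (X := c.pt) (c.π.app j)) ν)
    (x : c.pt) : dens μ x ≤ dens ν x := by
  by_contra! hlt
  have hpos : 0 < dens μ x := (dens_nonneg _ _).trans_lt hlt
  let T : Aᵒᵖ → Set c.pt := fun j =>
    {y | c.π.app j y = c.π.app j x} ∩ {y | dens μ x ≤ dens ν y}
  have hTc : ∀ j, IsClosed (T j) := fun j =>
    (isClosed_eq (c.π.app j).hom.hom.continuous continuous_const).inter (isClosed_le_dens ν _)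
  have hmono : ∀ {i j : Aᵒᵖ} (_ : i ⟶ j), T i ⊆ T j := by
    rintro i j f y ⟨hy1, hy2⟩
    refine ⟨?_, hy2⟩
    have hy1 : c.π.app i y = c.π.app i x := hy1
    change c.π.app j y = c.π.app j x
    rw [← map_π_app c f, ← map_π_app c f, hy1]
  have hTn : ∀ j, (T j).Nonempty := fun j => by
    have h1 := dens_le_dens_map (homMap (X := c.pt) (c.π.app j)) μ x
    rw [h j] at h1
    obtain ⟨y, hy1, hy2⟩ := exists_dens_map_eq _ ν (hpos.trans_le h1)
    exact ⟨y, hy1, h1.trans hy2.ge⟩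
  obtain ⟨y, hy⟩ := IsCompact.nonempty_iInter_of_directed_nonempty_isCompact_isClosed T
    (fun i j => ⟨IsCofiltered.min i j, hmono (IsCofiltered.minToLeft i j),
      hmono (IsCofiltered.minToRight i j)⟩) hTn (fun j => (hTc j).isCompact) hTc
  rw [Set.mem_iInter] at hy
  have hyx : y = x := hinj y x fun j => (hy j).1
  have := (hy (Classical.arbitrary _)).2
  rw [hyx] at this
  exact absurd this (not_le.2 hlt)

variable {s : ∀ j, IdempMeas (K.obj j)}

/-- Points of positive density lift to threads along which the density does not decrease. -/
theorem exists_lift_le_dens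
    (hs : ∀ {i j : Aᵒᵖ} (f : i ⟶ j), map (homMap (K.map f)) (s i) = s j)
    (hsurj : ∀ t : ∀ j, K.obj j, (∀ {i j : Aᵒᵖ} (f : i ⟶ j), K.map f (t i) = t j) →
      ∃ x : c.pt, ∀ j, c.π.app j x = t j)
    {j : Aᵒᵖ} {z : K.obj j} (hz : 0 < dens (s j) z) :
    ∃ x : c.pt, c.π.app j x = z ∧ ∀ i, dens (s j) z ≤ dens (s i) (c.π.app i x) := by
  have hdens : ∀ {i k : Aᵒᵖ} (f : i ⟶ k) (y : K.obj i),
      dens (s i) y ≤ dens (s k) (K.map f y) := fun f y => by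
    rw [← hs f]
    exact dens_le_dens_map (homMap (K.map f)) _ y
  have hcomp : ∀ {i k l : Aᵒᵖ} (f : i ⟶ k) (g : k ⟶ l) (y : K.obj i),
      K.map g (K.map f y) = K.map (f ≫ g) y := fun f g y => by
    rw [K.map_comp]; rfl
  obtain ⟨t, ht1, ht2⟩ := exists_thread_mem K
    (fun i => {y | dens (s j) z ≤ dens (s i) y} ∩ ⋂ f : i ⟶ j, {y | K.map f y = z})
    (fun i => (isClosed_le_dens _ _).inter (isClosed_iInter fun f =>
      isClosed_eq (K.map f).hom.hom.continuous continuous_const))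
    (fun i => by
      -- To find a point at index i, lift z to an index above both i and j in A, then project to i;
      -- arrows of the index category are unique.
      let f := IsCofiltered.minToRight i j
      have hz' := hz
      rw [← hs f] at hz'
      obtain ⟨y, hy1, hy2⟩ := exists_dens_map_eq (homMap (K.map f)) _ hz'
      rw [hs f] at hy2
      refine ⟨K.map (IsCofiltered.minToLeft i j) y, hy2.ge.trans (hdens _ y), ?_⟩
      refine Set.mem_iInter.2 fun g => ?_
      change K.map g (K.map (IsCofiltered.minToLeft i j) y) = z
      rw [hcomp, Subsingleton.elim (IsCofiltered.minToLeft i j ≫ g) f]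
      exact hy1)
    (fun {i k} f y hy => ⟨le_trans hy.1 (hdens f y), Set.mem_iInter.2 fun g => by
      change K.map g (K.map f y) = z
      rw [hcomp]
      exact Set.mem_iInter.1 hy.2 _⟩)
  obtain ⟨x, hx⟩ := hsurj t ht2
  refine ⟨x, ?_, fun i => ?_⟩
  · rw [hx, ← ht2 (𝟙 j)]
    exact Set.mem_iInter.1 (ht1 j).2 (𝟙 j)
  · rw [hx]
    exact (ht1 i).1

theorem exists_map_π_eq [Nonempty A]
    (hs : ∀ {i j : Aᵒᵖ} (f : i ⟶ j), map (homMap (K.map f)) (s i) = s j)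
    (hsurj : ∀ t : ∀ j, K.obj j, (∀ {i j : Aᵒᵖ} (f : i ⟶ j), K.map f (t i) = t j) →
      ∃ x : c.pt, ∀ j, c.π.app j x = t j) :
    ∃ μ : IdempMeas c.pt, ∀ j, map (homMap (X := c.pt) (c.π.app j)) μ = s j := by
  -- The expected density of the limit measure; `exists_lift_le_dens` shows that the infimum loses
  -- nothing over a suitable lift.
  let w : c.pt → ℝ := fun x => ⨅ j, dens (s j) (c.π.app j x)
  have hw : ∀ x j, w x ≤ dens (s j) (c.π.app j x) := fun x j =>
    ciInf_le ⟨0, by rintro _ ⟨i, rfl⟩; exact dens_nonneg _ _⟩ j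
  have h0 : ∀ x, 0 ≤ w x := fun x => Real.iInf_nonneg fun _ => dens_nonneg _ _
  have h1 : ∀ x, w x ≤ 1 := fun x => (hw x (Classical.arbitrary _)).trans (dens_le_one _ _)
  have hz : ∃ x, w x = 1 := by
    obtain ⟨z, hz⟩ := exists_dens_eq_one (s (Classical.arbitrary _))
    obtain ⟨x, -, hx⟩ := exists_lift_le_dens c hs hsurj (z := z) (hz ▸ one_pos)
    exact ⟨x, le_antisymm (h1 x) (le_ciInf fun i => hz ▸ hx i)⟩
  refine ⟨mix w dirac h0 h1 hz, fun j => Subtype.ext (funext fun φ => ?_)⟩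
  refine mix_apply_eq (φ := φ.comp (homMap (X := c.pt) (c.π.app j))) h0 h1 hz
    (fun x => ?_) ?_
  · exact (mul_le_mul_of_nonneg_right (hw x j) (Real.exp_pos _).le).trans
      (dens_mul_exp_le (s j) φ (c.π.app j x))
  · obtain ⟨z, hφ⟩ := exists_dens_mul_exp_eq (s j) φ
    have hpos : 0 < dens (s j) z := by
      refine (dens_nonneg _ _).lt_of_ne fun h => ?_
      rw [← h, zero_mul] at hφ
      exact (Real.exp_pos _).ne hφ
    obtain ⟨x, hx, hle⟩ := exists_lift_le_dens c hs hsurj hpos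
    refine ⟨x, ?_⟩
    rw [← hφ, ← hx]
    refine mul_le_mul_of_nonneg_right (le_ciInf fun i => ?_) (Real.exp_pos _).le
    rw [hx]
    exact hle i

end IdempMeas

theorem preservesLimitsOfShape_idempFunctor [Nonempty A] :
    PreservesLimitsOfShape Aᵒᵖ idempFunctor.{u} where
  preservesLimit {K} :=
    { preserves := fun {c} hc => by
        obtain hT := (Types.isLimit_iff _).1 ⟨isLimitOfPreserves (forget CompHaus.{u}) hc⟩
        have hinj : ∀ x y : c.pt, (∀ j, c.π.app j x = c.π.app j y) → x = y := by
          intro x y hxy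
          obtain ⟨z, -, hz⟩ := hT (fun j => c.π.app j y)
            (fun f => map_π_app c f y)
          exact (hz x hxy).trans (hz y fun _ => rfl).symm
        have hsurj : ∀ t : ∀ j, K.obj j, (∀ {i j : Aᵒᵖ} (f : i ⟶ j), K.map f (t i) = t j) →
            ∃ x : c.pt, ∀ j, c.π.app j x = t j := fun t ht => (hT t ht).exists
        have hI : Nonempty (IsLimit ((forget CompHaus.{u}).mapCone (idempFunctor.mapCone c))) := by
          rw [Types.isLimit_iff]
          intro s hs
          obtain ⟨μ, hμ⟩ := IdempMeas.exists_map_π_eq c (s := s) (fun f => hs f) hsurj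
          refine ⟨μ, hμ, fun ν hν => IdempMeas.ext_dens fun x => le_antisymm ?_ ?_⟩
          · exact IdempMeas.dens_le_of_map_π_eq c hinj
              (fun j => (hν j).trans (hμ j).symm) x
          · exact IdempMeas.dens_le_of_map_π_eq c hinj
              (fun j => (hμ j).trans (hν j).symm) x
        exact ⟨isLimitOfReflects (forget CompHaus.{u}) hI.some⟩ }

end Limits

/-! ### Seminormality and the unit laws. -/

theorem isSeminormal_idempFunctor : IsSeminormal idempFunctor.{u} where
  empty X hX := ⟨fun μ => by
    obtain ⟨x, -⟩ := IdempMeas.exists_dens_eq_one (X := X) μ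
    exact hX.false x⟩
  singleton X hX := by
    obtain ⟨hX⟩ := hX
    refine ⟨⟨⟨IdempMeas.dirac (default : X)⟩, fun μ => ?_⟩⟩
    refine Subtype.ext (funext fun φ => ?_)
    have : φ = ContinuousMap.const X (φ default) := by
      ext x; rw [Subsingleton.elim x default]; rfl
    rw [this]
    exact μ.2.1 _
  intersections X B := by
    have key : ∀ (C : TopologicalSpace.Closeds X) (μ : IdempMeas X),
        μ ∈ Set.range (idempFunctor.map (closedIncl X C)) ↔
          {x | 0 < IdempMeas.dens μ x} ⊆ (C : Set X) := fun C μ =>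
      IdempMeas.exists_map_subtype_val_eq_iff C.isClosed
    ext μ
    simp only [Set.mem_iInter]
    refine (key _ μ).trans ?_
    simp only [TopologicalSpace.Closeds.coe_sInf, Set.subset_iInter_iff]
    exact forall₂_congr fun C _ => (key C μ).symm
  monomorphic X Y f hf := IdempMeas.map_injective (f := homMap f) hf
  continuous A _ _ _ := preservesLimitsOfShape_idempFunctor

theorem isSemimonadic_idempFunctor :
    IsSemimonadic idempFunctor.{u} idempUnit.{u} idempMult.{u} where
  map_unit _ _ := rfl
  unit_map _ _ := rfl

/-! ### The density rule is a metrization with P1–P7. -/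

section DensRule

/-- The rule `d ↦ densDist d`. -/
def densRule : DistRule idempFunctor.{u} :=
  fun _ d => IdempMeas.densDist d

theorem isMetrization_densRule : IsMetrization densRule.{u} := by
  intro X d hd
  obtain ⟨B, hB⟩ := hd.exists_bound
  refine IsCompatibleMetric.of_mem_nhds (fun μ ν => ⟨?_, ?_⟩)
    (IdempMeas.densDist_comm d) (IdempMeas.densDist_triangle hd.nonneg hB hd.triangle)
    (fun μ ε hε => IdempMeas.densDist_lt_mem_nhds hd.nonneg hd.symm hd.self_eq hd.triangle
      hd.continuous μ hε)
  · exact IdempMeas.eq_of_densDist_eq_zero hd.nonneg hB fun U hU => (hd.isOpen_iff U).1 hU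
  · rintro rfl
    exact IdempMeas.densDist_self hd.self_eq μ

variable {X Y : CompHaus.{u}} {d : X → X → ℝ} {d' : Y → Y → ℝ}

theorem isCompatibleMetric_iterDist_densRule (hd : IsCompatibleMetric X d) (n : ℕ) :
    IsCompatibleMetric _ (iterDist densRule X d n) := by
  induction n with
  | zero => exact hd
  | succ n ih => exact isMetrization_densRule _ _ ih

theorem densRule_unit (hd : IsCompatibleMetric X d) (x y : X) :
    densRule X d (idempUnit.app X x) (idempUnit.app X y) = d x y := by
  obtain ⟨B, hB⟩ := hd.exists_bound
  exact IdempMeas.densDist_dirac_dirac hd.nonneg hB hd.symm x y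

theorem densRule_far_from_unit (hd : IsCompatibleMetric X d) {ε : ℝ} {μ : idempFunctor.obj X}
    (h : ∀ x, ε ≤ densRule X d μ (idempUnit.app X x)) (ν : idempFunctor.obj X) :
    ε ≤ densRule _ (densRule X d) (idempFunctor.map (idempUnit.app X) μ)
      (idempUnit.app _ ν) := by
  obtain ⟨B, hB⟩ := hd.exists_bound
  exact IdempMeas.le_densDist_map_dirac hd.nonneg hB hd.symm h ν

/-- At distances below δ the factor e^ε suffices; beyond δ, K is so large that the linear term alone
exceeds e^B. -/
theorem exists_exp_modulus (hd : IsCompatibleMetric X d) (hd' : IsCompatibleMetric Y d')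
    {f : X → Y} (hf : Continuous f) {ε : ℝ} (hε : 0 < ε) :
    ∃ K, 1 ≤ K ∧ ∀ x y,
      Real.exp (d' (f x) (f y)) ≤ Real.exp ε * (1 + K * (Real.exp (d x y) - 1)) := by
  obtain ⟨δ, hδ, h⟩ := hd.uniformContinuous hd' hf hε
  obtain ⟨B, hB⟩ := hd'.exists_bound
  have hδ' : 0 < Real.exp δ - 1 := sub_pos.2 (Real.one_lt_exp_iff.2 hδ)
  refine ⟨max 1 (Real.exp B / (Real.exp δ - 1)), le_max_left _ _, fun x y => ?_⟩
  set K := max 1 (Real.exp B / (Real.exp δ - 1))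
  have hK : 0 ≤ K := zero_le_one.trans (le_max_left _ _)
  have hE := IdempMeas.exp_sub_one_nonneg (hd.nonneg x y)
  rcases lt_or_ge (d x y) δ with hxy | hxy
  · exact (Real.exp_le_exp.2 (h x y hxy).le).trans
      (le_mul_of_one_le_right (Real.exp_pos _).le (by linarith [mul_nonneg hK hE]))
  · have h1 : Real.exp B ≤ K * (Real.exp (d x y) - 1) := by
      calc Real.exp B = Real.exp B / (Real.exp δ - 1) * (Real.exp δ - 1) :=
            (div_mul_cancel₀ _ hδ'.ne').symm
        _ ≤ K * (Real.exp (d x y) - 1) :=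
            mul_le_mul (le_max_right _ _) (sub_le_sub_right (Real.exp_le_exp.2 hxy) 1) hδ'.le hK
    calc Real.exp (d' (f x) (f y)) ≤ Real.exp B := Real.exp_le_exp.2 (hB _ _)
      _ ≤ 1 + K * (Real.exp (d x y) - 1) := by linarith
      _ ≤ _ := le_mul_of_one_le_left (by linarith [mul_nonneg hK hE]) (Real.one_le_exp hε.le)

theorem exists_common_modulus_densRule (hd : IsCompatibleMetric X d)
    (hd' : IsCompatibleMetric Y d') (f : X ⟶ Y) {ε : ℝ} (hε : 0 < ε) :
    ∃ δ > 0, ∀ (n : ℕ) (a b : (iter idempFunctor n).obj X), iterDist densRule X d n a b < δ →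
      iterDist densRule Y d' n ((iter idempFunctor n).map f a)
        ((iter idempFunctor n).map f b) < ε := by
  obtain ⟨K, hK, h⟩ := exists_exp_modulus hd hd' (homMap f).continuous (half_pos hε)
  have hK0 : 0 < K := one_pos.trans_le hK
  have key : ∀ (n : ℕ) (a b : (iter idempFunctor n).obj X),
      Real.exp (iterDist densRule Y d' n ((iter idempFunctor n).map f a)
        ((iter idempFunctor n).map f b)) ≤
          Real.exp (ε / 2) * (1 + K * (Real.exp (iterDist densRule X d n a b) - 1)) := by
    intro n
    induction n with
    | zero => exact h
    | succ n ih =>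
      have hn := isCompatibleMetric_iterDist_densRule hd n
      obtain ⟨B, hB⟩ := hn.exists_bound
      exact IdempMeas.exp_densDist_map_le hn.nonneg hB (homMap ((iter idempFunctor n).map f))
        (Real.one_le_exp (half_pos hε).le) hK ih
  have he : 0 < (Real.exp (ε / 2) - 1) / K :=
    div_pos (sub_pos.2 (Real.one_lt_exp_iff.2 (half_pos hε))) hK0
  -- This δ solves 1 + K(e^δ − 1) = e^{ε/2}, independently of n.
  refine ⟨Real.log (1 + (Real.exp (ε / 2) - 1) / K), Real.log_pos (by linarith), ?_⟩
  intro n a b hab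
  rw [← Real.exp_lt_exp] at hab ⊢
  rw [Real.exp_log (by linarith)] at hab
  refine (key n a b).trans_lt ?_
  have h1 : K * (Real.exp (iterDist densRule X d n a b) - 1) < Real.exp (ε / 2) - 1 := by
    rw [mul_comm, ← lt_div_iff₀ hK0]
    linarith
  calc _ < Real.exp (ε / 2) * Real.exp (ε / 2) :=
        mul_lt_mul_of_pos_left (by linarith) (Real.exp_pos _)
    _ = Real.exp ε := by rw [← Real.exp_add, add_halves]

theorem perfectProperties_densRule :
    PerfectProperties idempUnit.{u} idempMult.{u} densRule.{u} where
  P1 X₁ X₂ d₁ d₂ h₁ h₂ i hi a b :=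
    IdempMeas.densDist_map_of_isometry (homMap i) (fun x y hxy => by
      rw [← h₁.eq_zero_iff, ← hi, h₂.eq_zero_iff]; exact hxy) hi a b
  P2 X d hd := densRule_unit hd
  P3 X d hd := diameter_eq_of_isometry (η := idempUnit.app X) hd (densRule_unit hd)
    (fun ⟨μ⟩ => let ⟨x, _⟩ := IdempMeas.exists_dens_eq_one (X := X) μ; ⟨x⟩)
    (fun _ hB a b => IdempMeas.densDist_le_bound hd.nonneg hB a b)
  P4 X₁ X₂ d₁ d₂ h₁ h₂ f ε hε := by
    obtain ⟨δ, hδ, h⟩ := exists_common_modulus_densRule h₁ h₂ f hε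
    exact ⟨δ, hδ, fun p q => plusMap_uniformContinuous idempUnit densRule
      (fun n => densRule_unit (isCompatibleMetric_iterDist_densRule h₁ n))
      (fun n => densRule_unit (isCompatibleMetric_iterDist_densRule h₂ n)) f h p q⟩
  P5 X d hd a b := by
    obtain ⟨B, hB⟩ := hd.exists_bound
    exact IdempMeas.densDist_join_le hd.nonneg hB a b
  P6 X d hd a x := by
    obtain ⟨B, hB⟩ := hd.exists_bound
    exact IdempMeas.densDist_join_dirac hd.nonneg hB hd.symm a x

theorem propertyP7_densRule : PropertyP7 idempUnit.{u} densRule.{u} where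
  far_from_unit _ _ hd _ _ h := densRule_far_from_unit hd h
  iterated X d hd _ _ h := le_iterDist_qMap idempUnit densRule X d h
    fun n _ => densRule_far_from_unit (isCompatibleMetric_iterDist_densRule hd n)

end DensRule

/-! ### The transport rule has P1–P7. -/

section TransportRule

variable {X Y : CompHaus.{u}} {d : X → X → ℝ} {d' : Y → Y → ℝ} {B : ℝ}

theorem iterDist_transportRule_mem_Icc (h0 : ∀ x y, 0 ≤ d x y) (hB : ∀ x y, d x y ≤ B) (n : ℕ) :
    (∀ a b, 0 ≤ iterDist transportRule X d n a b) ∧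
      ∀ a b, iterDist transportRule X d n a b ≤ B := by
  induction n with
  | zero => exact ⟨h0, hB⟩
  | succ n ih =>
    exact ⟨fun a b => IdempMeas.transportDist_nonneg ih.1 a b,
      fun a b => IdempMeas.transportDist_le_bound ih.1 ih.2 a b⟩

theorem iterDist_transportRule_unitStep (hd : IsCompatibleMetric X d) (n : ℕ)
    (a b : (iter idempFunctor n).obj X) :
    iterDist transportRule X d (n + 1) (unitStep idempUnit X n a) (unitStep idempUnit X n b)
      = iterDist transportRule X d n a b := by
  obtain ⟨B, hB⟩ := hd.exists_bound
  obtain ⟨h1, h2⟩ := iterDist_transportRule_mem_Icc hd.nonneg hB n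
  exact IdempMeas.transportDist_dirac_dirac h1 h2 a b

theorem exists_common_modulus_transportRule (hd : IsCompatibleMetric X d)
    (hd' : IsCompatibleMetric Y d') (f : X ⟶ Y) {ε : ℝ} (hε : 0 < ε) :
    ∃ δ > 0, ∀ (n : ℕ) (a b : (iter idempFunctor n).obj X),
      iterDist transportRule X d n a b < δ →
        iterDist transportRule Y d' n ((iter idempFunctor n).map f a)
          ((iter idempFunctor n).map f b) < ε := by
  obtain ⟨δ, hδ, h⟩ := hd.uniformContinuous hd' (homMap f).continuous (half_pos hε)
  obtain ⟨B, hB⟩ := hd.exists_bound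
  obtain ⟨B', hB'⟩ := hd'.exists_bound
  -- The induction keeps the non-strict bound ε/2, which `transportDist_map_le` reproduces at the
  -- next level with the same δ; strictness is recovered only at the end.
  refine ⟨δ, hδ, fun n a b hab => lt_of_le_of_lt ?_ (half_lt_self hε)⟩
  induction n with
  | zero => exact (h a b hab).le
  | succ n ih =>
    exact IdempMeas.transportDist_map_le (iterDist_transportRule_mem_Icc hd.nonneg hB n).2
      (iterDist_transportRule_mem_Icc hd'.nonneg hB' n).1
      (homMap ((iter idempFunctor n).map f)) ih hab

theorem perfectProperties_transportRule :
    PerfectProperties idempUnit.{u} idempMult.{u} transportRule.{u} where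
  P1 X₁ X₂ d₁ d₂ h₁ h₂ i hi a b := by
    obtain ⟨B₁, hB₁⟩ := h₁.exists_bound
    obtain ⟨B₂, hB₂⟩ := h₂.exists_bound
    exact IdempMeas.transportDist_map_of_isometry h₁.nonneg
      (fun x y => (hB₁ x y).trans (le_max_left B₁ B₂)) h₂.nonneg
      (fun x y => (hB₂ x y).trans (le_max_right B₁ B₂)) (homMap i) (fun x y hxy => by
        rw [← h₁.eq_zero_iff, ← hi, h₂.eq_zero_iff]; exact hxy) hi a b
  P2 X d hd := iterDist_transportRule_unitStep hd 0
  P3 X d hd := diameter_eq_of_isometry (η := idempUnit.app X) hd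
    (iterDist_transportRule_unitStep hd 0)
    (fun ⟨μ⟩ => let ⟨x, _⟩ := IdempMeas.exists_dens_eq_one (X := X) μ; ⟨x⟩)
    (fun _ hB a b => IdempMeas.transportDist_le_bound hd.nonneg hB a b)
  P4 X₁ X₂ d₁ d₂ h₁ h₂ f ε hε := by
    obtain ⟨δ, hδ, h⟩ := exists_common_modulus_transportRule h₁ h₂ f hε
    exact ⟨δ, hδ, fun p q => plusMap_uniformContinuous idempUnit transportRule
      (iterDist_transportRule_unitStep h₁) (iterDist_transportRule_unitStep h₂) f h p q⟩
  P5 X d hd a b := by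
    obtain ⟨B, hB⟩ := hd.exists_bound
    exact IdempMeas.transportDist_join_le hd.nonneg hB hd.continuous a b
  P6 X d hd a x := by
    obtain ⟨B, hB⟩ := hd.exists_bound
    exact IdempMeas.transportDist_join_dirac hd.nonneg hB hd.continuous a x

theorem propertyP7_transportRule : PropertyP7 idempUnit.{u} transportRule.{u} where
  far_from_unit X d hd ε a h := by
    obtain ⟨B, hB⟩ := hd.exists_bound
    exact IdempMeas.le_transportDist_map_dirac hd.nonneg hB h
  iterated X d hd ε a h := le_iterDist_qMap idempUnit transportRule X d h fun n a h => by
    obtain ⟨B, hB⟩ := hd.exists_bound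
    obtain ⟨h1, h2⟩ := iterDist_transportRule_mem_Icc hd.nonneg hB n
    exact IdempMeas.le_transportDist_map_dirac h1 h2 h

end TransportRule

end

theorem mainTheorem2 :
    (IsSeminormal idempFunctor.{u} ∧
      IsSemimonadic idempFunctor.{u} idempUnit.{u} idempMult.{u} ∧
      ∃ D : DistRule idempFunctor.{u},
        IsMetrization D ∧ PerfectProperties idempUnit.{u} idempMult.{u} D ∧
          PropertyP7 idempUnit.{u} D) ∧
    (PerfectProperties idempUnit.{u} idempMult.{u} transportRule.{u} ∧
      PropertyP7 idempUnit.{u} transportRule.{u}) :=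
  ⟨⟨isSeminormal_idempFunctor, isSemimonadic_idempFunctor, densRule, isMetrization_densRule,
    perfectProperties_densRule, propertyP7_densRule⟩,
    perfectProperties_transportRule, propertyP7_transportRule⟩
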